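/- Let $n\ge 1$. A snake of length $n$ on the line (the graph with vertex set $\mathbb Z$ and edges $\{x,x\pm1\}$) is a walk $(v_0,\dots,v_n)$ in it; it is encoded by $(x,j)\in\mathbb Z\times\{0,1\}^n$ with $v_0=x$ and $v_l=v_{l-1}-(-1)^{j_l}$. Let $H_n$ be the bounded self-adjoint operator on $\ell^2(\mathbb Z\times\{0,1\}^n)$ with matrix $\langle s|H_n|s'\rangle=m_f(s,s')+m_b(s,s')\in\{0,1,2\}$, where $m_f(s,s')=1$ if $s'=(v_1,\dots,v_n,v_{n+1})$ for some $v_{n+1}$, $m_b(s,s')=1$ if $s'=(v_{-1},v_0,\dots,v_{n-1})$ for some $v_{-1}$ (with $s=(v_0,\dots,v_n)$), and both are $0$ otherwise. For $k\in\mathbb R$ let $|\tilde k\rangle=\frac1{\sqrt{2\pi}}\sum_{x\in\mathbb Z}e^{\mathrm ikx}|x\rangle$ and let $H_{n,k}$ be the operator on $\mathbb C^{\{0,1\}^n}$ $$H_{n,k}=\sum_{j\in\{0,1\}^{n-1}}e^{\mathrm ik}\big(|j0\rangle\langle0j|+|j1\rangle\langle0j|+|1j\rangle\langle j0|+|1j\rangle\langle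 j1|\big)+\sum_{j\in\{0,1\}^{n-1}}e^{-\mathrm ik}\big(|0j\rangle\langle j0|+|0j\rangle\langle j1|+|j0\rangle\langle1j|+|j1\rangle\langle1j|\big).$$ Let $|u_{b,k}\rangle=\frac1{\sqrt2}(e^{-\mathrm ik}|0\rangle+(-1)^be^{\mathrm ik}|1\rangle)$ and $|v_b\rangle=\frac1{\sqrt2}(|0\rangle+(-1)^b|1\rangle)$ for $b\in\{0,1\}$. Put $|\widehat0_k\rangle=-\mathrm i|u_{0,k}\rangle^{\otimes n}$, and for $1\le m<2^n$ with binary expansion $1m_L\dots m_1$, $L=\lfloor\log_2m\rfloor$, put $|\widehat m_k\rangle=|u_{0,k}\rangle^{\otimes(n-L-1)}|u_{1,k}\rangle|v_{m_L}\rangle\cdots|v_{m_1}\rangle$. Let $\Pi_{1,k}=|\widehat0_k\rangle\langle\widehat0_k|+\sum_{j=0}^{n-1}|\widehat{2^j}_k\rangle\langle\widehat{2^j}_k|$, and let $$K_n=\int_0^{2\pi}|\tilde k\rangle\langle\tilde k|\otimes\Pi_{1,k}H_{n,k}\Pi_{1,k}\,\mathrm dk,$$ i.e. $K_n$ is the bounded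 operator with $\langle x_2,j_2|K_n|x_1,j_1\rangle=\frac1{2\pi}\int_0^{2\pi}e^{\mathrm ik(x_2-x_1)}\langle j_2|\Pi_{1,k}H_{n,k}\Pi_{1,k}|j_1\rangle\,\mathrm dk$. Then for all $x_1,x_2\in\mathbb Z$ with $|x_1-x_2|>2n$, all $j_1,j_2\in\{0,1\}^n$ and all $t\in\mathbb R$, $$\langle x_2,j_2|e^{-\mathrm iH_nt}|x_1,j_1\rangle=\langle x_2,j_2|e^{-\mathrm iK_nt}|x_1,j_1\rangle .$$ -/

import Mathlib

open scoped ComplexConjugate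

namespace SnakeWalk

noncomputable section

/-! ### Bounded operators on `ℓ²` given by their matrix in the standard basis -/

/-- The Hilbert space `ℂ^U`, i.e. `ℓ²(U)`, with orthonormal basis `ket u`, `u ∈ U`. -/
abbrev Hilb (U : Type*) : Type _ := lp (fun _ : U => ℂ) 2

/-- The standard basis vector `|u⟩`. -/
def ket {U : Type*} [DecidableEq U] (u : U) : Hilb U := lp.single 2 u (1 : ℂ)

/-- `⟨u₁|T|u₂⟩ = w u₁ u₂` for all `u₁, u₂`. -/
def HasMatrix {U : Type*} [DecidableEq U] (T : Hilb U →L[ℂ] Hilb U) (w : U → U → ℂ) : Prop :=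
  ∀ u₁ u₂, inner ℂ (ket u₁) (T (ket u₂)) = w u₁ u₂

/-- A bounded operator is determined by its matrix. -/
theorem HasMatrix.unique {U : Type*} [DecidableEq U] {T T' : Hilb U →L[ℂ] Hilb U}
    {w : U → U → ℂ} (h : HasMatrix T w) (h' : HasMatrix T' w) : T = T' := by
  have hk : ∀ u, T (ket u) = T' (ket u) := by
    intro u
    apply lp.ext
    funext v
    have h1 := (h v u).trans (h' v u).symm
    simp only [ket, lp.inner_single_left] at h1
    simpa [ket] using h1
  ext1 f
  have hf := lp.hasSum_single (E := fun _ : U => ℂ) (p := 2) (by norm_num) f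
  have e : ∀ i, (lp.single 2 i (f i) : Hilb U) = f i • ket i := by
    intro i
    rw [ket, ← lp.single_smul]
    simp
  have h1 := T.hasSum hf
  have h2 := T'.hasSum hf
  refine h1.unique ?_
  convert h2 using 2 with i
  simp [e, hk]

/-- The (unique) bounded operator with a given matrix, for a matrix that has one. -/
def operatorOfMatrix {U : Type*} [DecidableEq U] (w : U → U → ℂ)
    (h : ∃ T : Hilb U →L[ℂ] Hilb U, HasMatrix T w) : Hilb U →L[ℂ] Hilb U :=
  h.choose

theorem operatorOfMatrix_hasMatrix {U : Type*} [DecidableEq U] (w : U → U → ℂ)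
    (h : ∃ T : Hilb U →L[ℂ] Hilb U, HasMatrix T w) : HasMatrix (operatorOfMatrix w h) w :=
  h.choose_spec

theorem exists_weighted_perm {U : Type*} (a : U → ℂ) (C : ℝ) (ha : ∀ u, ‖a u‖ ≤ C)
    (e : U ≃ U) : ∃ T : Hilb U →L[ℂ] Hilb U, ∀ f u, T f u = a u * f (e u) := by
  have h2 : (0 : ℝ) < (2 : ENNReal).toReal := by norm_num
  have hs : ∀ f : Hilb U, Summable fun u => ‖f (e u)‖ ^ (2 : ENNReal).toReal := fun f =>
    e.summable_iff.mpr ((lp.memℓp f).summable h2)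
  have hle : ∀ (f : Hilb U) u, ‖a u * f (e u)‖ ^ (2 : ENNReal).toReal ≤
      |C| ^ (2 : ENNReal).toReal * ‖f (e u)‖ ^ (2 : ENNReal).toReal := by
    intro f u
    rw [← Real.mul_rpow (abs_nonneg _) (norm_nonneg _), norm_mul]
    apply Real.rpow_le_rpow (by positivity) _ h2.le
    gcongr
    exact (ha u).trans (le_abs_self C)
  have hm : ∀ f : Hilb U, Memℓp (fun u => a u * f (e u)) 2 := fun f =>
    memℓp_gen (Summable.of_nonneg_of_le (fun u => by positivity) (hle f) ((hs f).mul_left _))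
  let L : Hilb U →ₗ[ℂ] Hilb U :=
    { toFun := fun f => ⟨fun u => a u * f (e u), hm f⟩
      map_add' := by
        intro f g
        apply lp.ext
        funext u
        exact mul_add _ _ _
      map_smul' := by
        intro c f
        apply lp.ext
        funext u
        simp [mul_left_comm] }
  refine ⟨L.mkContinuous |C| ?_, fun f u => rfl⟩
  intro f
  apply lp.norm_le_of_tsum_le h2 (by positivity)
  rw [Real.mul_rpow (abs_nonneg _) (norm_nonneg _), lp.norm_rpow_eq_tsum h2,
    ← e.tsum_eq (fun u => ‖f u‖ ^ (2 : ENNReal).toReal), ← tsum_mul_left]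
  exact Summable.tsum_le_tsum (hle f)
    (Summable.of_nonneg_of_le (fun u => by positivity) (hle f) ((hs f).mul_left _))
    ((hs f).mul_left _)

/-- A bounded matrix of finite bandwidth is the matrix of a bounded operator. -/
theorem exists_operator_of_band {G : Type*} [AddCommGroup G] [DecidableEq G] (w : G → G → ℂ)
    (F : Finset G) (C : ℝ) (hF : ∀ u v, w u v ≠ 0 → v - u ∈ F) (hC : ∀ u v, ‖w u v‖ ≤ C) :
    ∃ T : Hilb G →L[ℂ] Hilb G, HasMatrix T w := by
  choose T hT using fun g : G =>
    exists_weighted_perm (fun u => w u (u + g)) C (fun u => hC _ _) (Equiv.addRight g)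
  refine ⟨∑ g ∈ F, T g, fun u v => ?_⟩
  have key : ∀ g, inner ℂ (ket u) (T g (ket v)) = if g = v - u then w u v else 0 := by
    intro g
    simp only [ket, lp.inner_single_left, hT, lp.single_apply, Equiv.coe_addRight, Pi.single_apply]
    by_cases hg : g = v - u
    · subst hg
      simp
    · have : ¬ (u + g = v) := fun h => hg (by rw [← h]; abel)
      simp [this, hg]
  rw [_root_.sum_apply, inner_sum]
  simp only [key]
  rw [Finset.sum_ite_eq']
  split_ifs with h
  · rfl
  · by_contra h0
    exact h (hF u v (Ne.symm h0))

/-! ### Snakes in a graph -/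

/-- Snakes of length `n` in `G`: paths `(v₀, …, vₙ)`, vertices may repeat. -/
def Snake {V : Type*} (G : SimpleGraph V) (n : ℕ) : Type _ :=
  {v : Fin (n + 1) → V // ∀ l : Fin n, G.Adj (v l.castSucc) (v l.succ)}

/-- `s = (v₀, …, vₙ)` can move forward to `t`: `t = (v₁, …, vₙ₊₁)` for some `vₙ₊₁`. -/
def MovesForward {V : Type*} {G : SimpleGraph V} {n : ℕ} (s t : Snake G n) : Prop :=
  ∃ z : V, t.1 = Fin.snoc (α := fun _ => V) (fun l : Fin n => s.1 l.succ) z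

/-- `s = (v₀, …, vₙ)` can move backward to `t`: `t = (v₋₁, …, vₙ₋₁)` for some `v₋₁`. -/
def MovesBackward {V : Type*} {G : SimpleGraph V} {n : ℕ} (s t : Snake G n) : Prop :=
  ∃ z : V, t.1 = Fin.cons (α := fun _ => V) z (fun l : Fin n => s.1 l.castSucc)

open Classical in
/-- The matrix `A_n(G)_{s,t} = m_f(s,t) + m_b(s,t) ∈ {0, 1, 2}`. -/
def snakeMatrix {V : Type*} {G : SimpleGraph V} {n : ℕ} (s t : Snake G n) : ℕ :=
  (if MovesForward s t then 1 else 0) + (if MovesBackward s t then 1 else 0)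

/-! ### The line -/

/-- The line: vertex set `ℤ`, edges `(x, x ± 1)`. -/
def line : SimpleGraph ℤ where
  Adj x y := y = x + 1 ∨ y = x - 1
  symm := ⟨fun x y h => by omega⟩
  loopless := ⟨fun x h => by omega⟩

/-- Bit strings `{0,1}ⁿ`. -/
abbrev Bits (n : ℕ) : Type := Fin n → Fin 2

/-- Pairs `(x, j) ∈ ℤ × {0,1}ⁿ`. -/
abbrev Config (n : ℕ) : Type := ℤ × Bits n

/-- The vertex `v_l` of the snake `(x, j₁…jₙ)`: `v₀ = x` and `v_l = v_{l-1} - (-1)^{j_l}`. -/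
def snakeVertex {n : ℕ} (p : Config n) (l : Fin (n + 1)) : ℤ :=
  Fin.induction (motive := fun _ => ℤ) p.1 (fun i v => v - (-1) ^ (p.2 i : ℕ)) l

theorem snakeVertex_zero {n : ℕ} (p : Config n) : snakeVertex p 0 = p.1 := rfl

theorem snakeVertex_succ {n : ℕ} (p : Config n) (l : Fin n) :
    snakeVertex p l.succ = snakeVertex p l.castSucc - (-1) ^ (p.2 l : ℕ) := by
  simp [snakeVertex, Fin.induction_succ]

/-- The snake on the line encoded by `(x, j₁…jₙ)`. -/
def toSnake {n : ℕ} (p : Config n) : Snake line n :=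
  ⟨snakeVertex p, fun l => by
    rw [snakeVertex_succ]
    generalize p.2 l = b
    fin_cases b <;> simp [line]⟩

/-- The encoding of the snakes on the line by `ℤ × {0,1}ⁿ` is one-to-one and onto. -/
theorem toSnake_bijective (n : ℕ) : Function.Bijective (toSnake (n := n)) := by
  constructor
  · intro p q h
    have hv : ∀ l, snakeVertex p l = snakeVertex q l := fun l => congrFun (congrArg Subtype.val h) l
    refine Prod.ext (hv 0) (funext fun l => ?_)
    have h1 := hv l.succ
    rw [snakeVertex_succ, snakeVertex_succ, hv l.castSucc] at h1
    revert h1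
    generalize p.2 l = b
    generalize q.2 l = c
    fin_cases b <;> fin_cases c <;> simp <;> omega
  · rintro ⟨v, hv⟩
    refine ⟨(v 0, fun l => if v l.succ = v l.castSucc + 1 then 1 else 0), Subtype.ext ?_⟩
    funext l
    induction l using Fin.induction with
    | zero => rfl
    | succ l ih =>
      have ih' : snakeVertex (v 0, fun l : Fin n =>
        if v l.succ = v l.castSucc + 1 then (1 : Fin 2) else 0) l.castSucc = v l.castSucc := ih
      change snakeVertex _ l.succ = v l.succ
      rw [snakeVertex_succ, ih']
      rcases hv l with h | h
      · simp [h]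
      · have : ¬ v l.succ = v l.castSucc + 1 := by omega
        simp only [this, if_false]
        simp [h]

/-- The matrix of the Hamiltonian of the snake walk on the line, in the basis `|x, j⟩`. -/
def hamiltonianMatrix (n : ℕ) (p q : Config n) : ℂ := (snakeMatrix (toSnake p) (toSnake q) : ℂ)

theorem hamiltonian_exists (n : ℕ) (hn : 1 ≤ n) :
    ∃ T : Hilb (Config n) →L[ℂ] Hilb (Config n), HasMatrix T (hamiltonianMatrix n) := by
  refine exists_operator_of_band _ (Finset.Icc (-1) 1 ×ˢ Finset.univ) 2 ?_ ?_
  · intro p q h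
    obtain ⟨m, rfl⟩ : ∃ m, n = m + 1 := ⟨n - 1, by omega⟩
    have hp := snakeVertex_succ p 0
    have hq := snakeVertex_succ q 0
    rw [Fin.castSucc_zero, snakeVertex_zero] at hp hq
    have hpow : ∀ b : Fin 2, ((-1 : ℤ) ^ (b : ℕ)) = 1 ∨ ((-1 : ℤ) ^ (b : ℕ)) = -1 := by
      intro b
      fin_cases b <;> simp
    have hb : q.1 - p.1 = -1 ∨ q.1 - p.1 = 1 := by
      by_cases hf : MovesForward (toSnake p) (toSnake q)
      · obtain ⟨z, hz⟩ := hf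
        have h0 := congrFun hz (Fin.castSucc 0)
        rw [Fin.snoc_castSucc] at h0
        change q.1 = snakeVertex p (Fin.succ 0) at h0
        rcases hpow (p.2 0) with h1 | h1 <;> rw [h1] at hp <;> omega
      · by_cases hg : MovesBackward (toSnake p) (toSnake q)
        · obtain ⟨z, hz⟩ := hg
          have h0 := congrFun hz (Fin.succ 0)
          rw [Fin.cons_succ] at h0
          change snakeVertex q (Fin.succ 0) = p.1 at h0
          rcases hpow (q.2 0) with h1 | h1 <;> rw [h1] at hq <;> omega
        · exact absurd (by simp [hamiltonianMatrix, snakeMatrix, hf, hg]) h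
    simp only [Finset.mem_product, Finset.mem_Icc, Finset.mem_univ, and_true, Prod.fst_sub]
    omega
  · intro p q
    have h : snakeMatrix (toSnake p) (toSnake q) ≤ 2 := by
      unfold snakeMatrix
      split_ifs <;> omega
    rw [hamiltonianMatrix, Complex.norm_natCast]
    exact_mod_cast h

/-- The Hamiltonian `H_n = A_n(line)` as a bounded operator on `ℂ^{ℤ × {0,1}ⁿ}`, `n ≥ 1`. -/
def hamiltonian (n : ℕ) (hn : 1 ≤ n) : Hilb (Config n) →L[ℂ] Hilb (Config n) :=
  operatorOfMatrix (hamiltonianMatrix n) (hamiltonian_exists n hn)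

/-! ### The momentum blocks -/

/-- `|a⟩⟨b|` for bit strings `a, b`. -/
def ketbra {n : ℕ} (a b : Bits n) : Matrix (Bits n) (Bits n) ℂ := Matrix.single a b 1

/-- The block `H_{n,k}` (the case `n = 0` plays no role). -/
def blockHamiltonian : (n : ℕ) → ℝ → Matrix (Bits n) (Bits n) ℂ
  | 0, _ => 0
  | p + 1, k =>
    let r : Bits p → Fin 2 → Bits (p + 1) := fun j b => Fin.snoc (α := fun _ => Fin 2) j b
    let l : Fin 2 → Bits p → Bits (p + 1) := fun b j => Fin.cons (α := fun _ => Fin 2) b j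
    (∑ j : Bits p, Complex.exp (Complex.I * k) •
      (ketbra (r j 0) (l 0 j) + ketbra (r j 1) (l 0 j)
        + ketbra (l 1 j) (r j 0) + ketbra (l 1 j) (r j 1)))
    + ∑ j : Bits p, Complex.exp (-(Complex.I * k)) •
      (ketbra (l 0 j) (r j 0) + ketbra (l 0 j) (r j 1)
        + ketbra (r j 0) (l 1 j) + ketbra (r j 1) (l 1 j))

/-- `|u_{b,k}⟩ = (e^{-ik}|0⟩ + (-1)^b e^{ik}|1⟩)/√2`. -/
def uVec (b : Fin 2) (k : ℝ) : Fin 2 → ℂ :=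
  ![Complex.exp (-(Complex.I * k)) / (√2 : ℝ),
    (-1) ^ (b : ℕ) * Complex.exp (Complex.I * k) / (√2 : ℝ)]

/-- `|v_b⟩ = (|0⟩ + (-1)^b|1⟩)/√2`. -/
def vVec (b : Fin 2) : Fin 2 → ℂ := ![1 / (√2 : ℝ), (-1) ^ (b : ℕ) / (√2 : ℝ)]

/-- The tensor product of `n` vectors of `ℂ²`. -/
def tensor {n : ℕ} (f : Fin n → Fin 2 → ℂ) : Bits n → ℂ := fun j => ∏ l, f l (j l)

/-- The vector `|m̂_k⟩`: it is `-i |u_{0,k}⟩^{⊗n}` for `m = 0`, and for `m ≥ 1` with binary expansion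
`1 m_L … m_1`, where `L = ⌊log₂ m⌋`, it is `|u_{0,k}⟩^{⊗(n-L-1)} |u_{1,k}⟩ |v_{m_L}⟩ … |v_{m_1}⟩`.
The tensor factor with index `l` (counted from `0`) in the last group is `v` with the binary digit
of `m` of weight `2^(n-1-l)`. -/
def hatVec (n : ℕ) (k : ℝ) (m : ℕ) : Bits n → ℂ :=
  if m = 0 then (-Complex.I) • tensor (fun _ : Fin n => uVec 0 k)
  else tensor (fun l : Fin n =>
    if (l : ℕ) + Nat.log 2 m + 1 < n then uVec 0 k
    else if (l : ℕ) + Nat.log 2 m + 1 = n then uVec 1 k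
    else vVec (Fin.ofNat 2 (m / 2 ^ (n - 1 - (l : ℕ)))))

/-- `|ψ⟩⟨ψ|`. -/
def rankOne {n : ℕ} (ψ : Bits n → ℂ) : Matrix (Bits n) (Bits n) ℂ :=
  Matrix.vecMulVec ψ (star ψ)

/-- The projector `Π_{1,k} = |0̂_k⟩⟨0̂_k| + ∑_{j<n} |2̂^j_k⟩⟨2̂^j_k|`. -/
def blockProjector (n : ℕ) (k : ℝ) : Matrix (Bits n) (Bits n) ℂ :=
  rankOne (hatVec n k 0) + ∑ j ∈ Finset.range n, rankOne (hatVec n k (2 ^ j))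

/-! ### Fourier integrals of blocks -/

/-- The coordinates `⟨x|k̃⟩ = e^{ikx}/√(2π)` of the (non-normalizable) momentum state `|k̃⟩`. -/
def momentumState (k : ℝ) (x : ℤ) : ℂ :=
  Complex.exp (Complex.I * k * x) / (√(2 * Real.pi) : ℝ)

/-- The matrix of `∫_0^{2π} |k̃⟩⟨k̃| ⊗ M(k) dk` in the basis `|x, j⟩`. -/
def fourierIntegralMatrix {n : ℕ} (M : ℝ → Matrix (Bits n) (Bits n) ℂ) (p q : Config n) : ℂ :=
  ∫ k in (0 : ℝ)..(2 * Real.pi),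
    momentumState k p.1 * conj (momentumState k q.1) * M k p.2 q.2

/-- The character `k ↦ e^{imk}`. -/
def wave : Multiplicative ℤ →* (ℝ → ℂ) where
  toFun m k := Complex.exp (Complex.I * k * (Multiplicative.toAdd m : ℤ))
  map_one' := by
    funext k
    simp
  map_mul' a b := by
    funext k
    simp [mul_add, Complex.exp_add]

/-- Trigonometric polynomials. -/
def trigPoly : Subalgebra ℂ (ℝ → ℂ) := Algebra.adjoin ℂ (MonoidHom.mrange wave : Set (ℝ → ℂ))

theorem wave_mem (m : ℤ) : (fun k : ℝ => Complex.exp (Complex.I * k * m)) ∈ trigPoly :=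
  Algebra.subset_adjoin ⟨Multiplicative.ofAdd m, rfl⟩

theorem exp_mem : (fun k : ℝ => Complex.exp (Complex.I * k)) ∈ trigPoly := by
  simpa using wave_mem 1

theorem exp_neg_mem : (fun k : ℝ => Complex.exp (-(Complex.I * k))) ∈ trigPoly := by
  simpa using wave_mem (-1)

theorem const_mem (c : ℂ) : (fun _ : ℝ => c) ∈ trigPoly := trigPoly.algebraMap_mem c

theorem integral_wave (m : ℤ) (hm : m ≠ 0) :
    ∫ k in (0 : ℝ)..(2 * Real.pi), Complex.exp (Complex.I * k * m) = 0 := by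
  have hc : Complex.I * (m : ℂ) ≠ 0 := mul_ne_zero Complex.I_ne_zero (by exact_mod_cast hm)
  have h := integral_exp_mul_complex (a := 0) (b := 2 * Real.pi) hc
  have e : ∀ k : ℝ, Complex.I * k * m = Complex.I * m * k := fun k => by ring
  simp only [e]
  rw [h]
  have h1 : Complex.exp (Complex.I * m * ((2 * Real.pi : ℝ) : ℂ)) = 1 := by
    rw [← Complex.exp_int_mul_two_pi_mul_I m]
    congr 1
    push_cast
    ring
  rw [h1]
  simp

/-- A trigonometric polynomial has only finitely many non-zero Fourier coefficients. -/
theorem trigPoly_spec {f : ℝ → ℂ} (hf : f ∈ trigPoly) : Continuous f ∧ ∃ S : Finset ℤ, ∀ d ∉ S,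
    ∫ k in (0 : ℝ)..(2 * Real.pi), Complex.exp (Complex.I * k * d) * f k = 0 := by
  have hf' : f ∈ Submodule.span ℂ (MonoidHom.mrange wave : Set (ℝ → ℂ)) := by
    have h : f ∈ Subalgebra.toSubmodule trigPoly := hf
    rwa [trigPoly, Algebra.adjoin_eq_span, Submonoid.closure_eq] at h
  clear hf
  induction hf' using Submodule.span_induction with
  | mem f h =>
    obtain ⟨m, rfl⟩ := h
    refine ⟨?_, {-Multiplicative.toAdd m}, fun d hd => ?_⟩
    · change Continuous fun k : ℝ => Complex.exp (Complex.I * k * (Multiplicative.toAdd m : ℤ))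
      fun_prop
    · have hd' : d + Multiplicative.toAdd m ≠ 0 := by
        simp only [Finset.mem_singleton] at hd
        omega
      rw [← integral_wave _ hd']
      congr 1
      funext k
      change _ * Complex.exp (Complex.I * k * (Multiplicative.toAdd m : ℤ)) = _
      rw [← Complex.exp_add]
      congr 1
      push_cast
      ring
  | zero => exact ⟨continuous_zero, ∅, fun d _ => by simp⟩
  | add f g hf hg ihf ihg =>
    obtain ⟨cf, S, hS⟩ := ihf
    obtain ⟨cg, S', hS'⟩ := ihg
    refine ⟨cf.add cg, S ∪ S', fun d hd => ?_⟩
    simp only [Finset.mem_union, not_or] at hd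
    simp only [Pi.add_apply, mul_add]
    rw [intervalIntegral.integral_add, hS d hd.1, hS' d hd.2, add_zero]
    · exact Continuous.intervalIntegrable (by fun_prop) _ _
    · exact Continuous.intervalIntegrable (by fun_prop) _ _
  | smul c f hf ihf =>
    obtain ⟨cf, S, hS⟩ := ihf
    refine ⟨cf.const_smul c, S, fun d hd => ?_⟩
    simp only [Pi.smul_apply, smul_eq_mul, mul_left_comm _ c]
    rw [intervalIntegral.integral_const_mul, hS d hd, mul_zero]

theorem fourierIntegral_exists {n : ℕ} (M : ℝ → Matrix (Bits n) (Bits n) ℂ)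
    (hM : ∀ i j, (fun k => M k i j) ∈ trigPoly) :
    ∃ T : Hilb (Config n) →L[ℂ] Hilb (Config n), HasMatrix T (fourierIntegralMatrix M) := by
  choose S hS using fun ij : Bits n × Bits n => (trigPoly_spec (hM ij.1 ij.2)).2
  let g : Bits n → Bits n → ℤ → ℂ := fun i j d =>
    (1 / ((√(2 * Real.pi) : ℝ) * (√(2 * Real.pi) : ℝ))) *
      ∫ k in (0 : ℝ)..(2 * Real.pi), Complex.exp (Complex.I * k * d) * M k i j
  have hw : ∀ p q : Config n, fourierIntegralMatrix M p q = g p.2 q.2 (p.1 - q.1) := by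
    intro p q
    simp only [fourierIntegralMatrix, g]
    rw [← intervalIntegral.integral_const_mul]
    congr 1
    funext k
    have h1 : conj (momentumState k q.1) =
        Complex.exp (-(Complex.I * k * q.1)) / (√(2 * Real.pi) : ℝ) := by
      simp [momentumState, ← Complex.exp_conj]
    have h2 : Complex.exp (Complex.I * k * ((p.1 - q.1 : ℤ) : ℂ)) =
        Complex.exp (Complex.I * k * p.1) * Complex.exp (-(Complex.I * k * q.1)) := by
      rw [← Complex.exp_add]
      congr 1
      push_cast
      ring
    rw [h1, h2, momentumState]
    ring
  let D : Finset ℤ := Finset.univ.biUnion S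
  have hg : ∀ i j d, d ∉ D → g i j d = 0 := by
    intro i j d hd
    have : d ∉ S (i, j) := fun h => hd (Finset.mem_biUnion.mpr ⟨(i, j), Finset.mem_univ _, h⟩)
    simp only [g]
    rw [hS (i, j) d this, mul_zero]
  refine exists_operator_of_band _ ((D.image fun d => -d) ×ˢ Finset.univ)
    (∑ d ∈ D, ∑ i, ∑ j, ‖g i j d‖) ?_ ?_
  · intro p q h
    rw [hw] at h
    simp only [Finset.mem_product, Finset.mem_univ, and_true, Finset.mem_image, Prod.fst_sub]
    refine ⟨p.1 - q.1, ?_, by ring⟩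
    by_contra hd
    exact h (hg _ _ _ hd)
  · intro p q
    rw [hw]
    by_cases hd : p.1 - q.1 ∈ D
    · calc ‖g p.2 q.2 (p.1 - q.1)‖ ≤ ∑ j, ‖g p.2 j (p.1 - q.1)‖ :=
            Finset.single_le_sum (f := fun j => ‖g p.2 j (p.1 - q.1)‖)
              (fun _ _ => norm_nonneg _) (Finset.mem_univ _)
        _ ≤ ∑ i, ∑ j, ‖g i j (p.1 - q.1)‖ :=
            Finset.single_le_sum (f := fun i => ∑ j, ‖g i j (p.1 - q.1)‖)
              (fun _ _ => by positivity) (Finset.mem_univ _)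
        _ ≤ _ := Finset.single_le_sum (f := fun d => ∑ i, ∑ j, ‖g i j d‖)
              (fun _ _ => by positivity) hd
    · rw [hg _ _ _ hd, norm_zero]
      positivity

/-- The bounded operator `∫_0^{2π} |k̃⟩⟨k̃| ⊗ M(k) dk` for a matrix `M(k)` of trigonometric
polynomials. -/
def fourierIntegral {n : ℕ} (M : ℝ → Matrix (Bits n) (Bits n) ℂ)
    (hM : ∀ i j, (fun k => M k i j) ∈ trigPoly) : Hilb (Config n) →L[ℂ] Hilb (Config n) :=
  operatorOfMatrix (fourierIntegralMatrix M) (fourierIntegral_exists M hM)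

theorem fsum_mem {α : Type*} (s : Finset α) (f : α → ℝ → ℂ) (h : ∀ a ∈ s, f a ∈ trigPoly) :
    (fun k => ∑ a ∈ s, f a k) ∈ trigPoly := by
  have := trigPoly.sum_mem h
  convert this using 1
  funext k
  simp

theorem fprod_mem {α : Type*} (s : Finset α) (f : α → ℝ → ℂ) (h : ∀ a ∈ s, f a ∈ trigPoly) :
    (fun k => ∏ a ∈ s, f a k) ∈ trigPoly := by
  have := trigPoly.prod_mem h
  convert this using 1
  funext k
  simp

theorem uVec_mem (b i : Fin 2) : (fun k => uVec b k i) ∈ trigPoly ∧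
    (fun k => conj (uVec b k i)) ∈ trigPoly := by
  have hc : ∀ k : ℝ, conj (Complex.exp (Complex.I * k)) = Complex.exp (-(Complex.I * k)) :=
    fun k => by simp [← Complex.exp_conj]
  have hc' : ∀ k : ℝ, conj (Complex.exp (-(Complex.I * k))) = Complex.exp (Complex.I * k) :=
    fun k => by simp [← Complex.exp_conj]
  have hr : ∀ r : ℝ, conj ((r : ℂ)⁻¹) = (r : ℂ)⁻¹ := fun r => by simp
  fin_cases i
  · simp only [uVec, Fin.zero_eta, Matrix.cons_val_zero, div_eq_mul_inv, map_mul, hc', hr]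
    exact ⟨trigPoly.mul_mem exp_neg_mem (const_mem _), trigPoly.mul_mem exp_mem (const_mem _)⟩
  · simp only [uVec, Fin.mk_one, Matrix.cons_val_one, map_mul, hc, hr, div_eq_mul_inv,
      Matrix.cons_val_fin_one]
    exact ⟨trigPoly.mul_mem (trigPoly.mul_mem (const_mem _) exp_mem) (const_mem _),
      trigPoly.mul_mem (trigPoly.mul_mem (const_mem _) exp_neg_mem) (const_mem _)⟩

theorem hatVec_mem (n m : ℕ) (j : Bits n) : (fun k => hatVec n k m j) ∈ trigPoly ∧
    (fun k => conj (hatVec n k m j)) ∈ trigPoly := by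
  by_cases hm : m = 0
  · simp only [hatVec, hm, if_true, tensor, Pi.smul_apply, smul_eq_mul, map_mul, map_prod]
    exact ⟨trigPoly.mul_mem (const_mem _) (fprod_mem _ _ fun l _ => (uVec_mem _ _).1),
      trigPoly.mul_mem (const_mem _) (fprod_mem _ _ fun l _ => (uVec_mem _ _).2)⟩
  · simp only [hatVec, hm, if_false, tensor, map_prod]
    constructor <;> refine fprod_mem _ _ fun l _ => ?_
    · split_ifs
      exacts [(uVec_mem _ _).1, (uVec_mem _ _).1, const_mem _]
    · split_ifs
      exacts [(uVec_mem _ _).2, (uVec_mem _ _).2, const_mem _]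

theorem blockProjector_mem (n : ℕ) (i j : Bits n) :
    (fun k => blockProjector n k i j) ∈ trigPoly := by
  simp only [blockProjector, rankOne, Matrix.add_apply, Matrix.sum_apply, Matrix.vecMulVec_apply,
    Pi.star_apply]
  exact trigPoly.add_mem (trigPoly.mul_mem (hatVec_mem _ _ _).1 (hatVec_mem _ _ _).2)
    (fsum_mem _ _ fun a _ => trigPoly.mul_mem (hatVec_mem _ _ _).1 (hatVec_mem _ _ _).2)

theorem blockHamiltonian_mem (n : ℕ) (i j : Bits n) :
    (fun k => blockHamiltonian n k i j) ∈ trigPoly := by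
  cases n with
  | zero => exact const_mem 0
  | succ p =>
    simp only [blockHamiltonian, Matrix.add_apply, Matrix.sum_apply, Matrix.smul_apply,
      smul_eq_mul]
    exact trigPoly.add_mem
      (fsum_mem _ _ fun a _ => trigPoly.mul_mem exp_mem (const_mem _))
      (fsum_mem _ _ fun a _ => trigPoly.mul_mem exp_neg_mem (const_mem _))

/-- The block `Π_{1,k} H_{n,k} Π_{1,k}`. -/
def kDependentBlock (n : ℕ) (k : ℝ) : Matrix (Bits n) (Bits n) ℂ :=
  blockProjector n k * blockHamiltonian n k * blockProjector n k

theorem kDependentBlock_mem (n : ℕ) (i j : Bits n) :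
    (fun k => kDependentBlock n k i j) ∈ trigPoly := by
  simp only [kDependentBlock, Matrix.mul_apply]
  exact fsum_mem _ _ fun a _ => trigPoly.mul_mem
    (fsum_mem _ _ fun b _ => trigPoly.mul_mem (blockProjector_mem _ _ _)
      (blockHamiltonian_mem _ _ _)) (blockProjector_mem _ _ _)

/-- The operator `K_n = ∫_0^{2π} |k̃⟩⟨k̃| ⊗ Π_{1,k} H_{n,k} Π_{1,k} dk`. -/
def restrictedHamiltonian (n : ℕ) : Hilb (Config n) →L[ℂ] Hilb (Config n) :=
  fourierIntegral (kDependentBlock n) (kDependentBlock_mem n)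

/-- The time evolution `e^{-iHt}`. -/
def evolution {U : Type*} (H : Hilb U →L[ℂ] Hilb U) (t : ℝ) : Hilb U →L[ℂ] Hilb U :=
  NormedSpace.exp ((-(Complex.I * t)) • H)

end

end SnakeWalk

namespace SnakeWalk

noncomputable section

/-! ### Fourier coefficients of trigonometric polynomials -/

/-! Both operators are translation invariant with matrix-valued symbols: `H_{n,k}` for the snake
walk and `Π_{1,k} H_{n,k} Π_{1,k}` for `K_n`. Products of operators correspond to pointwise products
of symbols (`hasMatrix_mul`), so expanding the exponential reduces the claim to powers: for every
`r`, the entries of the `r`-th powers of the two symbols must have the same Fourier coefficients at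
`x` whenever `|x| > 2n`.

The symbol is `H_{n,k} = 2(S + S*)`, where `S` contracts the last tensor factor with `v_0` and
prepends `u_{0,k}`. In the orthonormal basis `chainVec`, labelled by bit strings, the factors are of
type `u` up to and including the first one and of type `v` afterwards. If a label has at least two
ones, its first factor is of type `u` and its last of type `v`, so `S` and `S*` merely shift the
label or annihilate the vector, with coefficients free of `k` (`blockHamiltonian_mulVec_chainVec`).
The shifts preserve the number of ones, hence the span of these heavy labels is invariant. As
`H_{n,k}` is Hermitian, the projector `E_k` onto this span commutes with it, and `Π_{1,k} = 1 - E_k`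
(`blockProjector_eq`).

Consequently, for `r ≥ 1`, the two powers differ by `H_{n,k}^r E_k = U_k C U_k*`, with `C` constant
in `k` and `U_k` the change of basis (`blockHamiltonian_pow_sub`). The entries of `U_k` and `U_k*`
are trigonometric polynomials of degree at most `n`, so those of the difference have degree at most
`2n` and no Fourier coefficient beyond `2n`. -/

/-- The Fourier coefficient `(2π)⁻¹ ∫_0^{2π} e^{ikx} f(k) dk`. -/
def fourierAt (x : ℤ) (f : ℝ → ℂ) : ℂ :=
  (2 * Real.pi : ℂ)⁻¹ * ∫ k in (0 : ℝ)..(2 * Real.pi), Complex.exp (Complex.I * k * x) * f k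

theorem fourierAt_wave (x m : ℤ) :
    fourierAt x (fun k : ℝ => Complex.exp (Complex.I * k * m)) = if x + m = 0 then 1 else 0 := by
  have e : ∀ k : ℝ, Complex.exp (Complex.I * k * x) * Complex.exp (Complex.I * k * m) =
      Complex.exp (Complex.I * k * (x + m : ℤ)) := fun k => by
    rw [← Complex.exp_add]
    congr 1
    push_cast
    ring
  simp only [fourierAt, e]
  split_ifs with h
  · rw [h]
    have : (Real.pi : ℂ) ≠ 0 := by exact_mod_cast Real.pi_ne_zero
    simp only [Int.cast_zero, mul_zero, Complex.exp_zero, intervalIntegral.integral_const, sub_zero,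
      Complex.real_smul, mul_one]
    push_cast
    field_simp
  · rw [integral_wave _ h, mul_zero]

theorem fourierAt_zero (x : ℤ) : fourierAt x 0 = 0 := by simp [fourierAt]

theorem fourierAt_add (x : ℤ) {f g : ℝ → ℂ} (hf : Continuous f) (hg : Continuous g) :
    fourierAt x (f + g) = fourierAt x f + fourierAt x g := by
  simp only [fourierAt, Pi.add_apply, mul_add]
  rw [intervalIntegral.integral_add, mul_add]
  · exact Continuous.intervalIntegrable (by fun_prop) _ _
  · exact Continuous.intervalIntegrable (by fun_prop) _ _

theorem fourierAt_smul (x : ℤ) (c : ℂ) (f : ℝ → ℂ) :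
    fourierAt x (c • f) = c * fourierAt x f := by
  simp only [fourierAt, Pi.smul_apply, smul_eq_mul, mul_left_comm _ c]
  rw [intervalIntegral.integral_const_mul]
  ring

theorem fourierAt_sub (x : ℤ) {f g : ℝ → ℂ} (hf : Continuous f) (hg : Continuous g) :
    fourierAt x (f - g) = fourierAt x f - fourierAt x g := by
  have : f - g = f + (-1 : ℂ) • g := by simp [sub_eq_add_neg]
  rw [this, fourierAt_add x hf (hg.const_smul _), fourierAt_smul]
  ring

theorem fourierAt_sum {ι : Type*} (s : Finset ι) (x : ℤ) {f : ι → ℝ → ℂ}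
    (hf : ∀ i ∈ s, Continuous (f i)) :
    fourierAt x (fun k => ∑ i ∈ s, f i k) = ∑ i ∈ s, fourierAt x (f i) := by
  simp only [fourierAt, Finset.mul_sum]
  rw [intervalIntegral.integral_finsetSum, Finset.mul_sum]
  intro i hi
  have := hf i hi
  exact Continuous.intervalIntegrable (by fun_prop) _ _

theorem fourierAt_mul_wave (x m : ℤ) (g : ℝ → ℂ) :
    fourierAt x (g * fun k : ℝ => Complex.exp (Complex.I * k * m)) = fourierAt (x + m) g := by
  simp only [fourierAt, Pi.mul_apply]
  congr 2
  funext k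
  rw [mul_left_comm, mul_comm, ← Complex.exp_add]
  congr 2
  push_cast
  ring

theorem trigPoly_continuous {f : ℝ → ℂ} (hf : f ∈ trigPoly) : Continuous f := (trigPoly_spec hf).1

/-- The characters are closed under multiplication, so the algebra they generate is already their
linear span; this allows arguments by linearity from a single character. -/
theorem trigPoly_eq_span :
    Subalgebra.toSubmodule trigPoly =
      Submodule.span ℂ (Set.range fun (m : ℤ) (k : ℝ) => Complex.exp (Complex.I * k * m)) := by
  rw [trigPoly, Algebra.adjoin_eq_span, Submonoid.closure_eq]
  congr 1

/-- The Fourier coefficients of a product are the convolution of the Fourier coefficients. -/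
theorem hasSum_fourierAt_mul {f g : ℝ → ℂ} (hf : f ∈ trigPoly) (hg : Continuous g) (x : ℤ) :
    HasSum (fun y : ℤ => fourierAt (x - y) g * fourierAt y f) (fourierAt x (g * f)) := by
  have h : f ∈ Submodule.span ℂ
      (Set.range fun (m : ℤ) (k : ℝ) => Complex.exp (Complex.I * k * m)) := by
    rw [← trigPoly_eq_span]
    exact hf
  clear hf
  -- Continuity travels through the induction because additivity of the coefficients needs
  -- integrability.
  suffices Continuous f ∧
    HasSum (fun y : ℤ => fourierAt (x - y) g * fourierAt y f) (fourierAt x (g * f)) from this.2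
  induction h using Submodule.span_induction with
  | mem f h =>
    obtain ⟨m, rfl⟩ := h
    refine ⟨by fun_prop, ?_⟩
    simp only [fourierAt_wave, fourierAt_mul_wave]
    convert hasSum_ite_eq (-m) (fourierAt (x + m) g) using 2 with y
    by_cases hy : y = -m
    · subst hy
      simp
    · rw [if_neg hy, if_neg (by omega), mul_zero]
  | zero =>
    refine ⟨continuous_zero, ?_⟩
    simp [fourierAt_zero, hasSum_zero]
  | add f₁ f₂ _ _ ih₁ ih₂ =>
    refine ⟨ih₁.1.add ih₂.1, ?_⟩
    simp only [fourierAt_add _ ih₁.1 ih₂.1, mul_add]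
    rw [fourierAt_add _ (hg.mul ih₁.1) (hg.mul ih₂.1)]
    exact ih₁.2.add ih₂.2
  | smul c f _ ih =>
    refine ⟨ih.1.const_smul c, ?_⟩
    simp only [fourierAt_smul, mul_smul_comm, mul_left_comm _ c]
    exact ih.2.mul_left c

/-! ### Bounded operators with a translation invariant matrix -/

/-- The positions enter only through their difference, which is what turns operator products into
convolutions. -/
theorem fourierIntegralMatrix_eq {n : ℕ} (M : ℝ → Matrix (Bits n) (Bits n) ℂ) (p q : Config n) :
    fourierIntegralMatrix M p q = fourierAt (p.1 - q.1) fun k => M k p.2 q.2 := by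
  simp only [fourierIntegralMatrix, fourierAt]
  rw [← intervalIntegral.integral_const_mul]
  congr 1
  funext k
  have h1 : conj (momentumState k q.1) =
      Complex.exp (-(Complex.I * k * q.1)) / (√(2 * Real.pi) : ℝ) := by
    simp [momentumState, ← Complex.exp_conj]
  have h2 : Complex.exp (Complex.I * k * ((p.1 - q.1 : ℤ) : ℂ)) =
      Complex.exp (Complex.I * k * p.1) * Complex.exp (-(Complex.I * k * q.1)) := by
    rw [← Complex.exp_add]
    congr 1
    push_cast
    ring
  have h3 : (2 * Real.pi : ℂ) = (√(2 * Real.pi) : ℝ) * (√(2 * Real.pi) : ℝ) := by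
    rw [← Complex.ofReal_mul, Real.mul_self_sqrt (by positivity)]
    push_cast
    rfl
  rw [h1, h2, momentumState, h3, mul_inv]
  ring

theorem inner_ket {U : Type*} [DecidableEq U] (u : U) (f : Hilb U) : inner ℂ (ket u) f = f u := by
  rw [ket, lp.inner_single_left]
  simp

theorem hasMatrix_apply {U : Type*} [DecidableEq U] {T : Hilb U →L[ℂ] Hilb U} {w : U → U → ℂ}
    (h : HasMatrix T w) (u v : U) : T (ket v) u = w u v := by
  rw [← h u v, inner_ket]

/-- Continuity of `T` and of the coordinate functional lets both pass through the expansion of `f`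
in the standard basis. -/
theorem hasSum_apply_of_hasMatrix {U : Type*} [DecidableEq U] {T : Hilb U →L[ℂ] Hilb U}
    {w : U → U → ℂ} (h : HasMatrix T w) (f : Hilb U) (u : U) :
    HasSum (fun v => w u v * f v) (T f u) := by
  have hf := T.hasSum (lp.hasSum_single (E := fun _ : U => ℂ) (p := 2) (by norm_num) f)
  have h1 := (innerSL ℂ (ket u)).hasSum hf
  have e : ∀ g : Hilb U, innerSL ℂ (ket u) g = g u := fun g => by
    rw [innerSL_apply_apply, inner_ket]
  rw [e] at h1
  refine h1.congr_fun fun v => ?_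
  rw [e]
  have : (lp.single 2 v (f v) : Hilb U) = f v • ket v := by
    rw [ket, ← lp.single_smul]
    simp
  rw [this, map_smul, lp.coeFn_smul, Pi.smul_apply, hasMatrix_apply h, smul_eq_mul, mul_comm]

/-- Summing over the intermediate position is a convolution of Fourier coefficients, hence a product
of symbols; summing over the intermediate bit string is matrix multiplication. -/
theorem hasMatrix_mul {n : ℕ} {T T' : Hilb (Config n) →L[ℂ] Hilb (Config n)}
    {M M' : ℝ → Matrix (Bits n) (Bits n) ℂ} (hT : HasMatrix T (fourierIntegralMatrix M))
    (hT' : HasMatrix T' (fourierIntegralMatrix M')) (hM : ∀ i j, (fun k => M k i j) ∈ trigPoly)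
    (hM' : ∀ i j, (fun k => M' k i j) ∈ trigPoly) :
    HasMatrix (T * T') (fourierIntegralMatrix fun k => M k * M' k) := by
  intro p q
  have h0 : inner ℂ (ket p) ((T * T') (ket q)) = T (T' (ket q)) p := by
    rw [inner_ket]
    rfl
  rw [h0, fourierIntegralMatrix_eq]
  have h1 := hasSum_apply_of_hasMatrix hT (T' (ket q)) p
  rw [← (Equiv.prodComm _ _).hasSum_iff] at h1
  -- The sum over intermediate configurations is regrouped with the bit string outside and the
  -- position inside.
  have h2 := h1.prod_fiberwise (g := fun j =>
    fourierAt (p.1 - q.1) ((fun k => M k p.2 j) * fun k => M' k j q.2)) ?_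
  · refine (h2.unique (hasSum_fintype _)).trans ?_
    simp only [Matrix.mul_apply]
    exact (fourierAt_sum _ _ fun j _ =>
      (trigPoly_continuous (hM _ _)).mul (trigPoly_continuous (hM' _ _))).symm
  · intro j
    have h3 := hasSum_fourierAt_mul (hM' j q.2) (trigPoly_continuous (hM p.2 j)) (p.1 - q.1)
    rw [← (Equiv.subRight q.1).hasSum_iff] at h3
    convert h3 using 2 with y
    simp only [Function.comp_apply, Equiv.prodComm_apply, Prod.swap_prod_mk, hasMatrix_apply hT',
      fourierIntegralMatrix_eq, Equiv.subRight_apply]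
    congr 2
    ring

theorem matrix_pow_mem {n : ℕ} {M : ℝ → Matrix (Bits n) (Bits n) ℂ}
    (hM : ∀ i j, (fun k => M k i j) ∈ trigPoly) (r : ℕ) (i j : Bits n) :
    (fun k => (M k ^ r) i j) ∈ trigPoly := by
  induction r generalizing j with
  | zero => simpa using const_mem ((1 : Matrix (Bits n) (Bits n) ℂ) i j)
  | succ r ih =>
    simp only [pow_succ, Matrix.mul_apply]
    exact fsum_mem _ _ fun a _ => trigPoly.mul_mem (ih a) (hM a j)

theorem hasMatrix_pow {n : ℕ} {T : Hilb (Config n) →L[ℂ] Hilb (Config n)}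
    {M : ℝ → Matrix (Bits n) (Bits n) ℂ} (hT : HasMatrix T (fourierIntegralMatrix M))
    (hM : ∀ i j, (fun k => M k i j) ∈ trigPoly) (r : ℕ) :
    HasMatrix (T ^ r) (fourierIntegralMatrix fun k => M k ^ r) := by
  induction r with
  | zero =>
    intro p q
    rw [fourierIntegralMatrix_eq, pow_zero, one_apply_eq_self, ket, ket,
      lp.inner_single_left]
    -- A constant symbol is a multiple of the character of index `0`, so its only coefficient sits
    -- at displacement `0`.
    have e : (fun k : ℝ => (M k ^ 0) p.2 q.2) = (1 : Matrix (Bits n) (Bits n) ℂ) p.2 q.2 •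
        fun k : ℝ => Complex.exp (Complex.I * k * (0 : ℤ)) := by
      funext k
      simp
    rw [e, fourierAt_smul, fourierAt_wave, Matrix.one_apply]
    simp only [lp.single_apply, Pi.single_apply, Prod.ext_iff]
    by_cases h1 : p.1 = q.1 <;> by_cases h2 : p.2 = q.2 <;> simp [h1, h2, sub_eq_zero]
  | succ r ih =>
    simp only [pow_succ]
    exact hasMatrix_mul ih hT (matrix_pow_mem hM r) hM

/-- The exponential series converges in operator norm and a matrix entry is a continuous linear
functional, so the evolution inherits equality from the powers. -/
theorem evolution_inner_eq {U : Type*} [DecidableEq U] {T T' : Hilb U →L[ℂ] Hilb U} {u v : U}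
    (h : ∀ r : ℕ, inner ℂ (ket u) ((T ^ r) (ket v)) = inner ℂ (ket u) ((T' ^ r) (ket v)))
    (t : ℝ) :
    inner ℂ (ket u) (evolution T t (ket v)) = inner ℂ (ket u) (evolution T' t (ket v)) := by
  have key : ∀ S : Hilb U →L[ℂ] Hilb U, HasSum (fun r : ℕ => ((r.factorial : ℂ)⁻¹ *
      (-(Complex.I * t)) ^ r) * inner ℂ (ket u) ((S ^ r) (ket v)))
      (inner ℂ (ket u) (evolution S t (ket v))) := by
    intro S
    have h1 := NormedSpace.exp_series_hasSum_exp' (𝕂 := ℂ) ((-(Complex.I * t)) • S)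
    have h2 := ((innerSL ℂ (ket u)).comp
      (ContinuousLinearMap.apply ℂ (Hilb U) (ket v))).hasSum h1
    refine h2.congr_fun fun r => ?_
    rw [smul_pow, smul_smul, map_smul, smul_eq_mul]
    rfl
  have h1 := key T
  simp only [h] at h1
  exact h1.unique (key T')

/-! ### Trigonometric polynomials of bounded degree -/

/-- Trigonometric polynomials of degree at most `d`. -/
def trigDegreeLE (d : ℕ) : Submodule ℂ (ℝ → ℂ) :=
  Submodule.span ℂ ((fun (m : ℤ) (k : ℝ) => Complex.exp (Complex.I * k * m)) ''
    {m | |m| ≤ (d : ℤ)})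

theorem wave_mem_trigDegreeLE {d : ℕ} (m : ℤ) (hm : |m| ≤ (d : ℤ)) :
    (fun k : ℝ => Complex.exp (Complex.I * k * m)) ∈ trigDegreeLE d :=
  Submodule.subset_span ⟨m, hm, rfl⟩

theorem const_mem_trigDegreeLE (c : ℂ) (d : ℕ) : (fun _ : ℝ => c) ∈ trigDegreeLE d := by
  have h := (trigDegreeLE d).smul_mem c (wave_mem_trigDegreeLE (d := d) 0 (by simp))
  convert h using 1
  funext k
  simp

theorem exp_mem_trigDegreeLE : (fun k : ℝ => Complex.exp (Complex.I * k)) ∈ trigDegreeLE 1 := by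
  simpa using wave_mem_trigDegreeLE (d := 1) 1 (by simp)

theorem exp_neg_mem_trigDegreeLE :
    (fun k : ℝ => Complex.exp (-(Complex.I * k))) ∈ trigDegreeLE 1 := by
  simpa using wave_mem_trigDegreeLE (d := 1) (-1) (by simp)

theorem mul_mem_trigDegreeLE {a b : ℕ} {f g : ℝ → ℂ} (hf : f ∈ trigDegreeLE a)
    (hg : g ∈ trigDegreeLE b) : (fun k => f k * g k) ∈ trigDegreeLE (a + b) := by
  have h := Submodule.mul_mem_mul hf hg
  rw [trigDegreeLE, trigDegreeLE, Submodule.span_mul_span] at h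
  refine Submodule.span_mono ?_ h
  rintro _ ⟨_, ⟨m, hm, rfl⟩, _, ⟨m', hm', rfl⟩, rfl⟩
  refine ⟨m + m', ?_, ?_⟩
  · have := abs_add_le m m'
    simp only [Set.mem_ofPred_eq, Nat.cast_add] at *
    omega
  · funext k
    simp only [Pi.mul_apply]
    rw [← Complex.exp_add]
    congr 1
    push_cast
    ring

theorem const_mul_mem_trigDegreeLE {d : ℕ} (c : ℂ) {f : ℝ → ℂ} (hf : f ∈ trigDegreeLE d) :
    (fun k => c * f k) ∈ trigDegreeLE d := (trigDegreeLE d).smul_mem c hf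

theorem sum_mem_trigDegreeLE {ι : Type*} {s : Finset ι} {d : ℕ} {f : ι → ℝ → ℂ}
    (hf : ∀ i ∈ s, f i ∈ trigDegreeLE d) : (fun k => ∑ i ∈ s, f i k) ∈ trigDegreeLE d := by
  convert (trigDegreeLE d).sum_mem hf using 1
  funext k
  simp

theorem prod_mem_trigDegreeLE {n : ℕ} {f : Fin n → ℝ → ℂ} (hf : ∀ i, f i ∈ trigDegreeLE 1) :
    (fun k => ∏ i, f i k) ∈ trigDegreeLE n := by
  induction n with
  | zero => simpa using const_mem_trigDegreeLE 1 0
  | succ n ih =>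
    simp only [Fin.prod_univ_castSucc]
    exact mul_mem_trigDegreeLE (ih fun i => hf i.castSucc) (hf _)

/-- A character of index `m` has its only coefficient at `x = -m`, and `|m| ≤ d`. -/
theorem fourierAt_eq_zero {d : ℕ} {f : ℝ → ℂ} (hf : f ∈ trigDegreeLE d) {x : ℤ}
    (hx : (d : ℤ) < |x|) : fourierAt x f = 0 := by
  suffices Continuous f ∧ fourierAt x f = 0 from this.2
  induction hf using Submodule.span_induction with
  | mem f h =>
    obtain ⟨m, hm, rfl⟩ := h
    refine ⟨by fun_prop, ?_⟩
    rw [fourierAt_wave, if_neg]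
    intro h
    rw [eq_neg_of_add_eq_zero_left h, abs_neg] at hx
    exact absurd hm (not_le.mpr hx)
  | zero => exact ⟨continuous_zero, fourierAt_zero x⟩
  | add f g _ _ ihf ihg =>
    exact ⟨ihf.1.add ihg.1, by rw [fourierAt_add x ihf.1 ihg.1, ihf.2, ihg.2, add_zero]⟩
  | smul c f _ ih => exact ⟨ih.1.const_smul c, by rw [fourierAt_smul, ih.2, mul_zero]⟩

/-! ### The orthonormal basis adapted to the block Hamiltonian -/

/-- The basis vector labelled by `a`: the factor at `l` is `u_{a l}` as long as `a` vanishes before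
`l`, and `v_{a l}` afterwards. -/
def chainVec {n : ℕ} (k : ℝ) (a : Bits n) : Bits n → ℂ :=
  tensor fun l => if ∀ l' < l, a l' = 0 then uVec (a l) k else vVec (a l)

theorem sqrt_two_inv_mul_self : ((√2 : ℝ) : ℂ)⁻¹ * ((√2 : ℝ) : ℂ)⁻¹ = 1 / 2 := by
  rw [← mul_inv, ← Complex.ofReal_mul, Real.mul_self_sqrt (by norm_num)]
  norm_num

theorem star_exp (k : ℝ) : conj (Complex.exp (Complex.I * k)) = Complex.exp (-(Complex.I * k)) := by
  simp [← Complex.exp_conj]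

theorem star_exp_neg (k : ℝ) :
    conj (Complex.exp (-(Complex.I * k))) = Complex.exp (Complex.I * k) := by
  simp [← Complex.exp_conj]

theorem exp_mul_exp_neg (k : ℝ) :
    Complex.exp (Complex.I * k) * Complex.exp (-(Complex.I * k)) = 1 := by
  rw [← Complex.exp_add, add_neg_cancel, Complex.exp_zero]

theorem uVec_inner (k : ℝ) (b c : Fin 2) :
    ∑ i, conj (uVec b k i) * uVec c k i = if b = c then 1 else 0 := by
  have h1 := sqrt_two_inv_mul_self
  have h2 := exp_mul_exp_neg k
  fin_cases b <;> fin_cases c <;>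
    simp [uVec, Fin.sum_univ_two, star_exp, star_exp_neg, div_eq_mul_inv] <;> grind

theorem vVec_inner (b c : Fin 2) :
    ∑ i, conj (vVec b i) * vVec c i = if b = c then 1 else 0 := by
  have h1 := sqrt_two_inv_mul_self
  fin_cases b <;> fin_cases c <;>
    simp [vVec, Fin.sum_univ_two, div_eq_mul_inv] <;> grind

theorem tensor_inner {n : ℕ} (f g : Fin n → Fin 2 → ℂ) :
    ∑ j, conj (tensor f j) * tensor g j = ∏ l, ∑ i, conj (f l i) * g l i := by
  simp only [tensor, map_prod, ← Finset.prod_mul_distrib]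
  exact (Fintype.prod_sum fun l i => conj (f l i) * g l i).symm

/-- At the first position where two labels differ, their prefixes agree, so both factors there
belong to the same orthonormal pair, `u` or `v`, and are orthogonal. -/
theorem chainVec_inner {n : ℕ} (k : ℝ) (a b : Bits n) :
    ∑ j, conj (chainVec k a j) * chainVec k b j = if a = b then 1 else 0 := by
  rw [chainVec, chainVec, tensor_inner]
  split_ifs with h
  · subst h
    refine Finset.prod_eq_one fun l _ => ?_
    split_ifs
    · rw [uVec_inner, if_pos rfl]
    · rw [vVec_inner, if_pos rfl]
  · obtain ⟨l, hl, hmin⟩ : ∃ l, a l ≠ b l ∧ ∀ l' < l, a l' = b l' := by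
      obtain ⟨l, hl⟩ := Function.ne_iff.mp h
      obtain ⟨m, hm⟩ := WellFounded.has_min (wellFounded_lt (α := Fin n)) {l | a l ≠ b l} ⟨l, hl⟩
      exact ⟨m, hm.1, fun l' h' => by_contra fun h2 => hm.2 l' h2 h'⟩
    refine Finset.prod_eq_zero (Finset.mem_univ l) ?_
    have : (∀ l' < l, a l' = 0) ↔ ∀ l' < l, b l' = 0 :=
      forall₂_congr fun l' h' => by rw [hmin l' h']
    by_cases h1 : ∀ l' < l, b l' = 0
    · rw [if_pos h1, if_pos (this.mpr h1), uVec_inner, if_neg hl]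
    · rw [if_neg h1, if_neg (mt this.mp h1), vVec_inner, if_neg hl]

/-- The matrix whose columns are the vectors `chainVec k a`. -/
def chainMatrix (n : ℕ) (k : ℝ) : Matrix (Bits n) (Bits n) ℂ := fun i a => chainVec k a i

theorem conjTranspose_chainMatrix_mul (n : ℕ) (k : ℝ) :
    (chainMatrix n k).conjTranspose * chainMatrix n k = 1 := by
  ext a b
  rw [Matrix.mul_apply, Matrix.one_apply, ← chainVec_inner k a b]
  rfl

theorem chainMatrix_mul_conjTranspose (n : ℕ) (k : ℝ) :
    chainMatrix n k * (chainMatrix n k).conjTranspose = 1 :=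
  mul_eq_one_comm.mp (conjTranspose_chainMatrix_mul n k)

theorem uVec_mem_trigDegreeLE (b i : Fin 2) : (fun k => uVec b k i) ∈ trigDegreeLE 1 ∧
    (fun k => conj (uVec b k i)) ∈ trigDegreeLE 1 := by
  fin_cases i
  · simp only [uVec, Fin.zero_eta, Matrix.cons_val_zero, map_mul, map_inv₀, star_exp_neg,
      Complex.conj_ofReal, div_eq_inv_mul]
    exact ⟨const_mul_mem_trigDegreeLE _ exp_neg_mem_trigDegreeLE,
      const_mul_mem_trigDegreeLE _ exp_mem_trigDegreeLE⟩
  · simp only [uVec, Fin.mk_one, Matrix.cons_val_one, Matrix.cons_val_fin_one, map_mul, map_inv₀,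
      map_pow, map_neg, map_one, star_exp, Complex.conj_ofReal, div_eq_inv_mul]
    exact ⟨const_mul_mem_trigDegreeLE _ (const_mul_mem_trigDegreeLE _ exp_mem_trigDegreeLE),
      const_mul_mem_trigDegreeLE _ (const_mul_mem_trigDegreeLE _ exp_neg_mem_trigDegreeLE)⟩

theorem chainMatrix_mem_trigDegreeLE {n : ℕ} (i a : Bits n) :
    (fun k => chainMatrix n k i a) ∈ trigDegreeLE n ∧
      (fun k => conj (chainMatrix n k i a)) ∈ trigDegreeLE n := by
  simp only [chainMatrix, chainVec, tensor, map_prod]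
  constructor <;> refine prod_mem_trigDegreeLE fun l => ?_
  · split_ifs
    exacts [(uVec_mem_trigDegreeLE _ _).1, const_mem_trigDegreeLE _ _]
  · split_ifs
    exacts [(uVec_mem_trigDegreeLE _ _).2, const_mem_trigDegreeLE _ _]

/-- This is the source of the bound `2n`: each of the two changes of basis contributes degree `n`,
one for each tensor factor, and the middle matrix is constant in `k`. -/
theorem chainMatrix_conj_mem_trigDegreeLE {n : ℕ} (C : Matrix (Bits n) (Bits n) ℂ) (i j : Bits n) :
    (fun k => (chainMatrix n k * C * (chainMatrix n k).conjTranspose) i j) ∈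
      trigDegreeLE (2 * n) := by
  rw [two_mul]
  simp only [Matrix.mul_apply, Matrix.conjTranspose_apply]
  refine sum_mem_trigDegreeLE fun b _ => mul_mem_trigDegreeLE (sum_mem_trigDegreeLE fun a _ => ?_)
    (chainMatrix_mem_trigDegreeLE j b).2
  simpa only [mul_comm] using
    const_mul_mem_trigDegreeLE (C a b) (chainMatrix_mem_trigDegreeLE i a).1

/-! ### The entries of the block Hamiltonian -/

/-- The phase `e^{-ik}` for `b = 0` and `e^{ik}` for `b = 1`. -/
def hopPhase (b : Fin 2) (k : ℝ) : ℂ :=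
  if b = 0 then Complex.exp (-(Complex.I * k)) else Complex.exp (Complex.I * k)

theorem snoc_eq_iff {p : ℕ} (w : Bits p) (b : Fin 2) (i : Bits (p + 1)) :
    (Fin.snoc (α := fun _ => Fin 2) w b : Bits (p + 1)) = i ↔
      w = Fin.init i ∧ i (Fin.last p) = b := by
  constructor
  · rintro rfl
    simp
  · rintro ⟨rfl, rfl⟩
    exact Fin.snoc_init_self i

theorem cons_eq_iff {p : ℕ} (w : Bits p) (b : Fin 2) (i : Bits (p + 1)) :
    (Fin.cons (α := fun _ => Fin 2) b w : Bits (p + 1)) = i ↔ w = Fin.tail i ∧ i 0 = b := by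
  constructor
  · rintro rfl
    simp
  · rintro ⟨rfl, rfl⟩
    exact Fin.cons_self_tail i

theorem sum_ketbra_snoc_cons {p : ℕ} (b c : Fin 2) (i j : Bits (p + 1)) :
    ∑ w : Bits p, ketbra (Fin.snoc (α := fun _ => Fin 2) w b : Bits (p + 1))
        (Fin.cons (α := fun _ => Fin 2) c w : Bits (p + 1)) i j =
      if Fin.tail j = Fin.init i ∧ i (Fin.last p) = b ∧ j 0 = c then 1 else 0 := by
  simp only [ketbra, Matrix.single_apply, snoc_eq_iff, cons_eq_iff]
  rw [Finset.sum_eq_single (Fin.init i)]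
  · simp only [true_and]
    congr 1
    rw [eq_iff_iff, eq_comm (a := Fin.init i)]
    tauto
  · intro w _ hw
    simp [hw]
  · simp

theorem ketbra_swap {p : ℕ} (a b i j : Bits p) : ketbra a b i j = ketbra b a j i := by
  simp only [ketbra, Matrix.single_apply, and_comm]

/-- The eight terms of the definition, grouped there by phase, are regrouped by direction of motion;
in each direction the phase is fixed by the first bit of one of the two strings. -/
theorem blockHamiltonian_apply {p : ℕ} (k : ℝ) (i j : Bits (p + 1)) :
    blockHamiltonian (p + 1) k i j =
      (if Fin.tail i = Fin.init j then hopPhase (i 0) k else 0) +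
        (if Fin.tail j = Fin.init i then conj (hopPhase (j 0) k) else 0) := by
  have h2 : ∀ c b, ∑ w : Bits p, ketbra (Fin.cons (α := fun _ => Fin 2) c w : Bits (p + 1))
        (Fin.snoc (α := fun _ => Fin 2) w b : Bits (p + 1)) i j =
      if Fin.tail i = Fin.init j ∧ j (Fin.last p) = b ∧ i 0 = c then 1 else 0 := by
    intro c b
    rw [← sum_ketbra_snoc_cons]
    exact Finset.sum_congr rfl fun w _ => ketbra_swap _ _ _ _
  have e1 : ∀ b : Fin 2, b = 0 ∨ b = 1 := by decide
  simp only [blockHamiltonian, Matrix.add_apply, Matrix.sum_apply, Matrix.smul_apply, smul_eq_mul,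
    ← Finset.mul_sum, Finset.sum_add_distrib, sum_ketbra_snoc_cons, h2]
  by_cases hA : Fin.tail i = Fin.init j <;> by_cases hB : Fin.tail j = Fin.init i <;>
  rcases e1 (i 0) with hi | hi <;> rcases e1 (j 0) with hj | hj <;>
  rcases e1 (i (Fin.last p)) with hi' | hi' <;> rcases e1 (j (Fin.last p)) with hj' | hj' <;>
  simp [hA, hB, hi, hj, hi', hj', hopPhase, star_exp, star_exp_neg] <;>
  ring

theorem blockHamiltonian_conjTranspose (n : ℕ) (k : ℝ) :
    (blockHamiltonian n k).conjTranspose = blockHamiltonian n k := by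
  cases n with
  | zero => simp [blockHamiltonian]
  | succ p =>
    ext i j
    rw [Matrix.conjTranspose_apply, blockHamiltonian_apply, blockHamiltonian_apply, star_add,
      add_comm]
    congr 1 <;> split_ifs <;> simp

/-! ### The Hamiltonian as a Fourier integral -/

theorem movesForward_iff {V : Type*} {G : SimpleGraph V} {n : ℕ} (s t : Snake G n) :
    MovesForward s t ↔ ∀ l : Fin n, t.1 l.castSucc = s.1 l.succ := by
  constructor
  · rintro ⟨z, hz⟩ l
    rw [hz, Fin.snoc_castSucc]
  · intro h
    refine ⟨t.1 (Fin.last n), funext fun l => ?_⟩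
    refine Fin.lastCases ?_ (fun l => ?_) l
    · rw [Fin.snoc_last]
    · rw [Fin.snoc_castSucc, h]

/-- A backward move is a forward move reversed, so only forward moves need to be analysed. -/
theorem movesBackward_iff {V : Type*} {G : SimpleGraph V} {n : ℕ} (s t : Snake G n) :
    MovesBackward s t ↔ MovesForward t s := by
  rw [movesForward_iff]
  constructor
  · rintro ⟨z, hz⟩ l
    rw [hz, Fin.cons_succ]
  · intro h
    refine ⟨t.1 0, funext fun l => ?_⟩
    refine Fin.cases ?_ (fun l => ?_) l
    · rw [Fin.cons_zero]
    · rw [Fin.cons_succ, h]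

theorem neg_one_pow_bit_inj {a b : Fin 2} (h : (-1 : ℤ) ^ (a : ℕ) = (-1) ^ (b : ℕ)) : a = b := by
  revert h
  fin_cases a <;> fin_cases b <;> simp

/-- Two walks on the overlapping vertices coincide exactly when their increments, i.e. their bits,
and their starting points coincide. -/
theorem movesForward_toSnake_iff {p : ℕ} (s t : Config (p + 1)) :
    MovesForward (toSnake s) (toSnake t) ↔
      Fin.tail s.2 = Fin.init t.2 ∧ s.1 - t.1 = (-1) ^ (s.2 0 : ℕ) := by
  rw [movesForward_iff]
  change (∀ l : Fin (p + 1), snakeVertex t l.castSucc = snakeVertex s l.succ) ↔ _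
  have h0 : snakeVertex s (Fin.succ 0) = s.1 - (-1) ^ (s.2 0 : ℕ) := by
    rw [snakeVertex_succ, Fin.castSucc_zero, snakeVertex_zero]
  have hs : ∀ l : Fin p, snakeVertex s l.succ.succ =
      snakeVertex s l.castSucc.succ - (-1) ^ (s.2 l.succ : ℕ) := fun l => by
    rw [snakeVertex_succ, ← Fin.succ_castSucc]
  have ht : ∀ l : Fin p, snakeVertex t l.succ.castSucc =
      snakeVertex t l.castSucc.castSucc - (-1) ^ (t.2 l.castSucc : ℕ) := fun l => by
    rw [← Fin.succ_castSucc, snakeVertex_succ]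
  constructor
  · intro h
    refine ⟨funext fun l => neg_one_pow_bit_inj ?_, ?_⟩
    · have h1 := h l.succ
      rw [ht, hs, h l.castSucc] at h1
      simp only [Fin.tail, Fin.init]
      linarith
    · have h1 := h 0
      rw [h0, Fin.castSucc_zero, snakeVertex_zero] at h1
      linarith
  · rintro ⟨h1, h2⟩ l
    induction l using Fin.induction with
    | zero =>
      rw [h0, Fin.castSucc_zero, snakeVertex_zero]
      linarith
    | succ l ih =>
      rw [ht, hs, ih]
      congr 3
      exact (congrFun h1 l).symm

theorem fourierAt_hopPhase (x : ℤ) (b : Fin 2) :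
    fourierAt x (hopPhase b) = if x = (-1) ^ (b : ℕ) then 1 else 0 := by
  change fourierAt x (fun k => hopPhase b k) = _
  fin_cases b
  · have := fourierAt_wave x (-1)
    simpa [hopPhase, add_neg_eq_zero] using this
  · have := fourierAt_wave x 1
    simpa [hopPhase, add_eq_zero_iff_eq_neg] using this

theorem fourierAt_conj_hopPhase (x : ℤ) (b : Fin 2) :
    fourierAt x (fun k => conj (hopPhase b k)) = if -x = (-1) ^ (b : ℕ) then 1 else 0 := by
  fin_cases b
  · have := fourierAt_wave x 1
    simpa [hopPhase, add_eq_zero_iff_eq_neg, neg_eq_iff_eq_neg, star_exp_neg] using this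
  · have := fourierAt_wave x (-1)
    simpa [hopPhase, add_neg_eq_zero, star_exp] using this

/-- The two summands of `blockHamiltonian_apply` are the symbols of the forward and the backward
move: the coefficients of a phase `e^{±ik}` form a delta at the displacement of the tail vertex. -/
theorem hamiltonian_hasMatrix (n : ℕ) (hn : 1 ≤ n) :
    HasMatrix (hamiltonian n hn) (fourierIntegralMatrix (blockHamiltonian n)) := by
  obtain ⟨p, rfl⟩ : ∃ p, n = p + 1 := ⟨n - 1, by omega⟩
  intro s t
  rw [hamiltonian, operatorOfMatrix_hasMatrix _ (hamiltonian_exists _ hn), hamiltonianMatrix,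
    snakeMatrix, movesBackward_iff, movesForward_toSnake_iff, movesForward_toSnake_iff,
    fourierIntegralMatrix_eq]
  simp only [blockHamiltonian_apply]
  have hc : ∀ b, Continuous (hopPhase b) := fun b => by
    unfold hopPhase
    split_ifs <;> fun_prop
  have e := fourierAt_add (s.1 - t.1)
    (f := fun k => if Fin.tail s.2 = Fin.init t.2 then hopPhase (s.2 0) k else 0)
    (g := fun k => if Fin.tail t.2 = Fin.init s.2 then conj (hopPhase (t.2 0) k) else 0)
    (by split_ifs; exacts [hc _, continuous_const])
    (by split_ifs; exacts [Complex.continuous_conj.comp (hc _), continuous_const])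
  refine Eq.trans ?_ e.symm
  push_cast
  congr 1
  · by_cases h : Fin.tail s.2 = Fin.init t.2
    · simp only [h, if_true, true_and]
      exact (fourierAt_hopPhase _ _).symm
    · simp only [h, if_false, false_and]
      exact (fourierAt_zero _).symm
  · by_cases h : Fin.tail t.2 = Fin.init s.2
    · simp only [h, if_true, true_and]
      rw [fourierAt_conj_hopPhase, neg_sub]
    · simp only [h, if_false, false_and]
      exact (fourierAt_zero _).symm

/-! ### The action of the block Hamiltonian on the basis -/

/-- The last bit affects no other factor, and the type of the last factor depends only on whether a
one occurs before it. -/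
theorem chainVec_init {p : ℕ} (k : ℝ) (a i : Bits (p + 1)) :
    chainVec k a i = chainVec k (Fin.init a) (Fin.init i) *
      (if Fin.init a = 0 then uVec (a (Fin.last p)) k else vVec (a (Fin.last p)))
        (i (Fin.last p)) := by
  simp only [chainVec, tensor, Fin.prod_univ_castSucc]
  congr 1
  · refine Finset.prod_congr rfl fun l _ => ?_
    have : (∀ l' < l.castSucc, a l' = 0) ↔ ∀ l' < l, (Fin.init a : Bits p) l' = 0 := by
      constructor
      · exact fun h l' hl => h l'.castSucc (Fin.castSucc_lt_castSucc_iff.mpr hl)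
      · intro h l' hl
        obtain ⟨m, rfl⟩ := Fin.exists_castSucc_eq.mpr (ne_of_lt (hl.trans (Fin.castSucc_lt_last l)))
        exact h m (Fin.castSucc_lt_castSucc_iff.mp hl)
    simp only [this]
    rfl
  · have : (∀ l' < Fin.last p, a l' = 0) ↔ (Fin.init a : Bits p) = 0 := by
      constructor
      · exact fun h => funext fun l => h _ (Fin.castSucc_lt_last l)
      · intro h l' hl
        obtain ⟨m, rfl⟩ := Fin.exists_castSucc_eq.mpr (ne_of_lt hl)
        exact congrFun h m
    simp only [this]

theorem chainVec_tail_of_eq_zero {p : ℕ} (k : ℝ) (a i : Bits (p + 1)) (h0 : a 0 = 0) :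
    chainVec k a i = uVec 0 k (i 0) * chainVec k (Fin.tail a) (Fin.tail i) := by
  simp only [chainVec, tensor, Fin.prod_univ_succ]
  congr 1
  · simp [h0]
  · refine Finset.prod_congr rfl fun l _ => ?_
    have : (∀ l' < l.succ, a l' = 0) ↔ ∀ l' < l, (Fin.tail a : Bits p) l' = 0 := by
      constructor
      · exact fun h l' hl => h l'.succ (Fin.succ_lt_succ_iff.mpr hl)
      · intro h l' hl
        induction l' using Fin.cases with
        | zero => exact h0
        | succ m => exact h m (Fin.succ_lt_succ_iff.mp hl)
    simp only [this]
    rfl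

/-- A leading one makes every later factor of type `v`, so the remainder is no longer a `chainVec`
of the tail. -/
theorem chainVec_tail_of_ne_zero {p : ℕ} (k : ℝ) (a i : Bits (p + 1)) (h0 : a 0 ≠ 0) :
    chainVec k a i = uVec (a 0) k (i 0) * tensor (fun l => vVec (a (Fin.succ l))) (Fin.tail i) := by
  simp only [chainVec, tensor, Fin.prod_univ_succ]
  congr 1
  · simp
  · refine Finset.prod_congr rfl fun l _ => ?_
    rw [if_neg fun h => h0 (h 0 (Fin.succ_pos l))]
    rfl

theorem sqrt_two_mul_self : ((√2 : ℝ) : ℂ) * ((√2 : ℝ) : ℂ) = 2 := by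
  rw [← Complex.ofReal_mul, Real.mul_self_sqrt (by norm_num)]
  norm_num

theorem sqrt_two_ne_zero : ((√2 : ℝ) : ℂ) ≠ 0 := by
  simp

theorem hopPhase_eq (b : Fin 2) (k : ℝ) : hopPhase b k = (√2 : ℝ) * uVec 0 k b := by
  have := sqrt_two_ne_zero
  fin_cases b <;> simp [hopPhase, uVec] <;> field_simp

theorem sum_vVec (b : Fin 2) : ∑ i, vVec b i = if b = 0 then ((√2 : ℝ) : ℂ) else 0 := by
  have h := sqrt_two_ne_zero
  have h2 := sqrt_two_mul_self
  fin_cases b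
  · simp only [vVec, Fin.sum_univ_two]
    simp
    field_simp
    grind
  · simp [vVec, div_eq_mul_inv]

theorem sum_conj_hopPhase_mul_uVec (b : Fin 2) (k : ℝ) :
    ∑ i, conj (hopPhase i k) * uVec b k i = if b = 0 then ((√2 : ℝ) : ℂ) else 0 := by
  have h := uVec_inner k 0 b
  simp only [hopPhase_eq, map_mul, Complex.conj_ofReal, mul_assoc, ← Finset.mul_sum, h, mul_ite,
    mul_one, mul_zero, eq_comm]

/-- The number of ones in a bit string. -/
def weight {n : ℕ} (a : Bits n) : ℕ := ∑ l, (a l : ℕ)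

theorem weight_init {p : ℕ} (a : Bits (p + 1)) :
    weight a = weight (Fin.init a : Bits p) + a (Fin.last p) := Fin.sum_univ_castSucc _

theorem weight_tail {p : ℕ} (a : Bits (p + 1)) :
    weight a = a 0 + weight (Fin.tail a : Bits p) := Fin.sum_univ_succ _

theorem weight_zero (n : ℕ) : weight (0 : Bits n) = 0 := by simp [weight]

/-- Drop the first bit and append a zero. -/
def shiftLeft {p : ℕ} (a : Bits (p + 1)) : Bits (p + 1) :=
  Fin.snoc (α := fun _ => Fin 2) (Fin.tail a) 0

/-- Drop the last bit and prepend a zero. -/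
def shiftRight {p : ℕ} (a : Bits (p + 1)) : Bits (p + 1) :=
  Fin.cons (α := fun _ => Fin 2) 0 (Fin.init a)

theorem weight_shiftLeft {p : ℕ} {a : Bits (p + 1)} (h : a 0 = 0) :
    weight (shiftLeft a) = weight a := by
  rw [weight_init, weight_tail a, h, shiftLeft, Fin.init_snoc, Fin.snoc_last]
  simp

theorem weight_shiftRight {p : ℕ} {a : Bits (p + 1)} (h : a (Fin.last p) = 0) :
    weight (shiftRight a) = weight a := by
  rw [weight_init a, weight_tail, h, shiftRight, Fin.tail_cons, Fin.cons_zero]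
  simp

theorem chainVec_shiftLeft {p : ℕ} (k : ℝ) {a : Bits (p + 1)} (i : Bits (p + 1))
    (h : (Fin.tail a : Bits p) ≠ 0) :
    chainVec k (shiftLeft a) i =
      chainVec k (Fin.tail a) (Fin.init i) * ((√2 : ℝ) : ℂ)⁻¹ := by
  rw [chainVec_init, shiftLeft, Fin.init_snoc, Fin.snoc_last, if_neg h]
  congr 1
  generalize i (Fin.last p) = b
  fin_cases b <;> simp [vVec]

theorem chainVec_shiftRight {p : ℕ} (k : ℝ) (a i : Bits (p + 1)) :
    chainVec k (shiftRight a) i = uVec 0 k (i 0) * chainVec k (Fin.init a) (Fin.tail i) := by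
  rw [chainVec_tail_of_eq_zero k _ _ (by simp [shiftRight]), shiftRight, Fin.tail_cons]

theorem sum_bits_snoc {p : ℕ} (f : Bits (p + 1) → ℂ) :
    ∑ j, f j = ∑ w : Bits p, ∑ b, f (Fin.snoc (α := fun _ => Fin 2) w b) := by
  rw [← (Fin.snocEquiv fun _ => Fin 2).sum_comp, Fintype.sum_prod_type, Finset.sum_comm]
  rfl

theorem sum_bits_cons {p : ℕ} (f : Bits (p + 1) → ℂ) :
    ∑ j, f j = ∑ w : Bits p, ∑ b, f (Fin.cons (α := fun _ => Fin 2) b w) := by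
  rw [← (Fin.consEquiv fun _ => Fin 2).sum_comp, Fintype.sum_prod_type, Finset.sum_comm]
  rfl

/-- Since the phases are `√2 u_{0,k}` and summing over a bit is `√2 ⟨v_0|`, this is the form `2(S +
S*)`: the first term contracts the last factor with `v_0` and prepends `u_{0,k}`, the second is its
adjoint. -/
theorem blockHamiltonian_mulVec {p : ℕ} (k : ℝ) (f : Bits (p + 1) → ℂ) (i : Bits (p + 1)) :
    ∑ j, blockHamiltonian (p + 1) k i j * f j =
      hopPhase (i 0) k * ∑ b, f (Fin.snoc (α := fun _ => Fin 2) (Fin.tail i) b) +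
        ∑ b, conj (hopPhase b k) * f (Fin.cons (α := fun _ => Fin 2) b (Fin.init i)) := by
  simp only [blockHamiltonian_apply, add_mul, Finset.sum_add_distrib, ite_mul, zero_mul]
  congr 1
  · rw [sum_bits_snoc]
    simp only [Fin.init_snoc, Finset.mul_sum]
    rw [Finset.sum_eq_single (Fin.tail i)]
    · simp
    · intro w _ hw
      simp [hw.symm]
    · simp
  · rw [sum_bits_cons]
    simp only [Fin.tail_cons, Fin.cons_zero]
    rw [Finset.sum_eq_single (Fin.init i)]
    · simp
    · intro w _ hw
      simp [hw]
    · simp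

/-- Two ones guarantee that a one survives the removal of either end bit. Hence the last factor is
some `v_b`, whose contraction with `v_0` is `0` or `1`, and an appended `v_0` is the factor that the
label `0` prescribes there. The first factor is always some `u_{b,k}`, contracted with `u_{0,k}`. -/
theorem blockHamiltonian_mulVec_chainVec {p : ℕ} (k : ℝ) {a : Bits (p + 1)} (ha : 2 ≤ weight a)
    (i : Bits (p + 1)) :
    ∑ j, blockHamiltonian (p + 1) k i j * chainVec k a j =
      (if a (Fin.last p) = 0 then 2 * chainVec k (shiftRight a) i else 0) +
        (if a 0 = 0 then 2 * chainVec k (shiftLeft a) i else 0) := by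
  have hinit : (Fin.init a : Bits p) ≠ 0 := by
    intro h
    rw [weight_init, h, weight_zero] at ha
    omega
  have htail : (Fin.tail a : Bits p) ≠ 0 := by
    intro h
    rw [weight_tail, h, weight_zero] at ha
    omega
  have h2 := sqrt_two_mul_self
  have hne := sqrt_two_ne_zero
  rw [blockHamiltonian_mulVec]
  congr 1
  · simp only [chainVec_init k a, Fin.init_snoc, Fin.snoc_last, if_neg hinit, ← Finset.mul_sum,
      sum_vVec, chainVec_shiftRight, hopPhase_eq]
    split_ifs
    · linear_combination uVec 0 k (i 0) * chainVec k (Fin.init a) (Fin.tail i) * h2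
    · ring
  · split_ifs with h0
    · simp only [chainVec_tail_of_eq_zero k a _ h0, Fin.cons_zero, Fin.tail_cons, ← mul_assoc,
        ← Finset.sum_mul, sum_conj_hopPhase_mul_uVec, if_true, chainVec_shiftLeft k i htail]
      field_simp
      linear_combination chainVec k (Fin.tail a) (Fin.init i) * h2
    · simp only [chainVec_tail_of_ne_zero k a _ h0, Fin.cons_zero, Fin.tail_cons, ← mul_assoc,
        ← Finset.sum_mul, sum_conj_hopPhase_mul_uVec, if_neg h0, zero_mul]

/-- The projector on the labels with at least two ones. -/
def heavyLabels (n : ℕ) : Matrix (Bits n) (Bits n) ℂ :=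
  Matrix.diagonal fun a => if 2 ≤ weight a then 1 else 0

/-- The block Hamiltonian in the basis `chainVec k`, restricted to labels with at least two ones;
it does not depend on `k`. -/
def chainHamiltonian (p : ℕ) : Matrix (Bits (p + 1)) (Bits (p + 1)) ℂ := fun b a =>
  if 2 ≤ weight a then
    (if b = shiftRight a ∧ a (Fin.last p) = 0 then 2 else 0) +
      (if b = shiftLeft a ∧ a 0 = 0 then 2 else 0)
  else 0

theorem heavyLabels_mul_self (n : ℕ) : heavyLabels n * heavyLabels n = heavyLabels n := by
  rw [heavyLabels, Matrix.diagonal_mul_diagonal]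
  congr 1
  funext a
  split_ifs <;> simp

/-- The shifts occur only when the dropped bit is `0`, so they preserve the number of ones. -/
theorem heavyLabels_mul_chainHamiltonian (p : ℕ) :
    heavyLabels (p + 1) * chainHamiltonian p = chainHamiltonian p := by
  ext b a
  rw [heavyLabels, Matrix.diagonal_mul]
  by_cases hb : 2 ≤ weight b
  · rw [if_pos hb, one_mul]
  · rw [if_neg hb, zero_mul, chainHamiltonian]
    split_ifs with ha h1 h2 h2
    · exact absurd ha (by rwa [← weight_shiftRight h1.2, ← h1.1])
    · exact absurd ha (by rwa [← weight_shiftRight h1.2, ← h1.1])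
    · exact absurd ha (by rwa [← weight_shiftLeft h2.2, ← h2.1])
    · simp
    · rfl

/-- Invariance of the heavy span as an intertwining relation `H U D = U D A` with `A` independent of
`k`, a form that iterates to powers. -/
theorem blockHamiltonian_mul_chainMatrix_mul_heavyLabels (p : ℕ) (k : ℝ) :
    blockHamiltonian (p + 1) k * (chainMatrix (p + 1) k * heavyLabels (p + 1)) =
      chainMatrix (p + 1) k * heavyLabels (p + 1) * chainHamiltonian p := by
  rw [mul_assoc, heavyLabels_mul_chainHamiltonian, ← mul_assoc]
  ext i a
  rw [heavyLabels, Matrix.mul_diagonal, Matrix.mul_apply, Matrix.mul_apply]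
  by_cases ha : 2 ≤ weight a
  · rw [if_pos ha, mul_one]
    refine (blockHamiltonian_mulVec_chainVec k ha i).trans ?_
    simp only [chainHamiltonian, if_pos ha, mul_add, Finset.sum_add_distrib, chainMatrix, mul_ite,
      mul_zero, ite_and, Finset.sum_ite_eq', Finset.mem_univ, if_true,
      mul_comm (2 : ℂ)]
  · simp [ha, chainHamiltonian]

/-! ### The complement of the projector -/

/-- Makes the phase `-i` in `|0̂_k⟩` irrelevant to the projector. -/
theorem rankOne_smul {n : ℕ} {c : ℂ} (hc : c * conj c = 1) (ψ : Bits n → ℂ) :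
    rankOne (c • ψ) = rankOne ψ := by
  ext i j
  simp only [rankOne, Matrix.vecMulVec_apply, Pi.star_apply, Pi.smul_apply, smul_eq_mul, star_mul']
  change c * ψ i * (conj c * conj (ψ j)) = ψ i * conj (ψ j)
  linear_combination ψ i * conj (ψ j) * hc

theorem rankOne_hatVec_zero (n : ℕ) (k : ℝ) :
    rankOne (hatVec n k 0) = rankOne (chainVec k (0 : Bits n)) := by
  have : chainVec k (0 : Bits n) = tensor fun _ => uVec 0 k := by simp [chainVec]
  rw [hatVec, if_pos rfl, rankOne_smul (by simp), this]

/-- The binary expansion of a power of two is a one followed by zeros; the exponent is reflected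
because the most significant bit comes first. -/
theorem hatVec_two_pow {n : ℕ} (k : ℝ) (l : Fin n) :
    hatVec n k (2 ^ (n - 1 - (l : ℕ))) = chainVec k (Pi.single l 1) := by
  rw [hatVec, if_neg (by positivity), chainVec, Nat.log_pow one_lt_two]
  congr 1
  funext m
  rcases lt_trichotomy m l with h | h | h
  · have h' : (m : ℕ) < l := h
    rw [if_pos (by omega), if_pos, Pi.single_eq_of_ne h.ne]
    intro l' hl
    exact Pi.single_eq_of_ne (hl.trans h).ne _
  · subst h
    rw [if_neg (by omega), if_pos (by omega), if_pos, Pi.single_eq_same]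
    intro l' hl
    exact Pi.single_eq_of_ne hl.ne _
  · have h' : (l : ℕ) < m := h
    have hm := m.2
    rw [if_neg (by omega), if_neg (by omega), if_neg, Pi.single_eq_of_ne h.ne',
      Nat.pow_div (by omega) two_pos]
    · congr 1
      -- Behind the leading one the quotient is a positive power of two, so its parity digit is `0`.
      obtain ⟨d, hd⟩ : ∃ d, n - 1 - (l : ℕ) - (n - 1 - (m : ℕ)) = d + 1 :=
        ⟨m - l - 1, by omega⟩
      rw [hd]
      ext
      simp [pow_succ]
    · intro hl
      have := hl l h
      simp at this

theorem weight_lt_two_iff {n : ℕ} (a : Bits n) :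
    weight a < 2 ↔ a = 0 ∨ ∃ l, Pi.single l 1 = a := by
  constructor
  · intro h
    by_cases h0 : a = 0
    · exact Or.inl h0
    · obtain ⟨l, hl⟩ := Function.ne_iff.mp h0
      refine Or.inr ⟨l, funext fun m => ?_⟩
      have pos : ∀ x, a x ≠ 0 → 1 ≤ (a x : ℕ) := fun x hx => by
        have := Fin.val_ne_zero_iff.mpr hx
        omega
      by_cases hm : m = l
      · subst hm
        rw [Pi.single_eq_same]
        have := pos m hl
        ext
        have := (a m).2
        simp
        omega
      · rw [Pi.single_eq_of_ne hm]
        by_contra hne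
        have h1 : ∑ x ∈ {l, m}, (a x : ℕ) ≤ weight a :=
          Finset.sum_le_sum_of_subset (Finset.subset_univ _)
        rw [Finset.sum_pair (Ne.symm hm)] at h1
        have := pos l hl
        have := pos m (Ne.symm hne)
        omega
  · rintro (rfl | ⟨l, rfl⟩)
    · simp [weight_zero]
    · rw [weight, Finset.sum_eq_single l]
      · simp
      · intro m _ hm
        simp [Pi.single_eq_of_ne hm]
      · simp

theorem sum_weight_lt_two {M : Type*} [AddCommMonoid M] {n : ℕ} (f : Bits n → M) :
    ∑ a, (if weight a < 2 then f a else 0) = f 0 + ∑ l : Fin n, f (Pi.single l 1) := by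
  have hS : Finset.univ.filter (fun a : Bits n => weight a < 2) =
      insert 0 (Finset.univ.image fun l : Fin n => (Pi.single l 1 : Bits n)) := by
    ext a
    rw [Finset.mem_filter, weight_lt_two_iff]
    simp
  rw [← Finset.sum_filter, hS, Finset.sum_insert, Finset.sum_image]
  · intro l _ m _ h
    by_contra hne
    have := congrFun h l
    simp [Pi.single_eq_of_ne hne] at this
  · simp

/-- `Π_{1,k}` projects onto the labels with at most one one; by completeness of the basis the
remaining labels make up its complement. -/
theorem blockProjector_eq (n : ℕ) (k : ℝ) :
    blockProjector n k =
      1 - chainMatrix n k * heavyLabels n * (chainMatrix n k).conjTranspose := by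
  have h : blockProjector n k = ∑ a, if weight a < 2 then rankOne (chainVec k a) else 0 := by
    rw [sum_weight_lt_two, blockProjector, rankOne_hatVec_zero, ← Finset.sum_range_reflect,
      Finset.sum_range]
    simp only [hatVec_two_pow]
  rw [h, ← chainMatrix_mul_conjTranspose n k]
  ext i j
  rw [Matrix.sub_apply, Matrix.mul_apply, Matrix.mul_apply, ← Finset.sum_sub_distrib,
    Matrix.sum_apply]
  refine Finset.sum_congr rfl fun a _ => ?_
  rw [heavyLabels, Matrix.mul_diagonal]
  by_cases ha : 2 ≤ weight a
  · rw [if_neg (by omega), if_pos ha]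
    simp
  · rw [if_pos (by omega), if_neg ha]
    simp [rankOne, Matrix.vecMulVec_apply, chainMatrix]

/-- If the idempotent `E` commutes with `H`, then the powers of `H` and of its compression
`(1 - E) H (1 - E)` differ only on the range of `E`. -/
theorem pow_sub_compression_pow {R : Type*} [Ring R] {H E : R} (hE : E * E = E)
    (hc : H * E = E * H) {r : ℕ} (hr : r ≠ 0) :
    H ^ r - ((1 - E) * H * (1 - E)) ^ r = H ^ r * E := by
  have hI : IsIdempotentElem (1 - E) := IsIdempotentElem.one_sub hE
  have hcomm : Commute H (1 - E) := (Commute.one_right H).sub_right hc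
  -- By commutation the compression is `H (1 - E)`, with `r`-th power `H ^ r * (1 - E)`. This fails
  -- for `r = 0`, where the compression also gives `1`.
  rw [← hcomm.eq, mul_assoc, hI.eq, hcomm.mul_pow, hI.pow_eq hr]
  noncomm_ring

/-- The difference lives on the heavy span, where the intertwining relation replaces `H_{n,k}` by a
constant matrix; `k` survives only in the outer changes of basis. -/
theorem blockHamiltonian_pow_sub {p : ℕ} (k : ℝ) {r : ℕ} (hr : r ≠ 0) :
    blockHamiltonian (p + 1) k ^ r - kDependentBlock (p + 1) k ^ r =
      chainMatrix (p + 1) k * (heavyLabels (p + 1) * chainHamiltonian p ^ r) *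
        (chainMatrix (p + 1) k).conjTranspose := by
  have hUU := conjTranspose_chainMatrix_mul (p + 1) k
  have hU := blockHamiltonian_mul_chainMatrix_mul_heavyLabels p k
  have hH := blockHamiltonian_conjTranspose (p + 1) k
  have hD := heavyLabels_mul_self (p + 1)
  have hDs : (heavyLabels (p + 1)).conjTranspose = heavyLabels (p + 1) := by
    rw [heavyLabels, Matrix.diagonal_conjTranspose]
    congr 1
    funext a
    simp only [Pi.star_apply]
    split_ifs <;> simp
  rw [kDependentBlock, blockProjector_eq]
  generalize blockHamiltonian (p + 1) k = H at *
  generalize chainMatrix (p + 1) k = U at *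
  generalize heavyLabels (p + 1) = D at *
  generalize chainHamiltonian p = A at *
  have hE : (U * D * U.conjTranspose) * (U * D * U.conjTranspose) = U * D * U.conjTranspose := by
    calc _ = U * (D * (U.conjTranspose * U) * D) * U.conjTranspose := by noncomm_ring
      _ = _ := by rw [hUU, mul_one, hD]
  -- The range of `E = U D U*` is invariant under `H`.
  have hEHE : (U * D * U.conjTranspose) * (H * (U * D * U.conjTranspose)) =
      H * (U * D * U.conjTranspose) := by
    calc _ = U * D * U.conjTranspose * (H * (U * D)) * U.conjTranspose := by noncomm_ring
      _ = U * (D * (U.conjTranspose * U) * D) * A * U.conjTranspose := by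
        rw [hU]
        noncomm_ring
      _ = H * (U * D) * U.conjTranspose := by rw [hUU, mul_one, hD, hU]
      _ = _ := by noncomm_ring
  have hEs : (U * D * U.conjTranspose).conjTranspose = U * D * U.conjTranspose := by
    simp [Matrix.conjTranspose_mul, hDs, mul_assoc]
  -- Taking adjoints of `E H E = H E` with `H` and `E` Hermitian gives `E H E = E H`, so the two
  -- commute.
  have hc : H * (U * D * U.conjTranspose) = (U * D * U.conjTranspose) * H := by
    have h1 := congrArg Matrix.conjTranspose hEHE
    rw [Matrix.conjTranspose_mul, Matrix.conjTranspose_mul, hEs, hH] at h1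
    rw [← hEHE, ← h1, ← mul_assoc]
  have hpow : H ^ r * (U * D) = U * D * A ^ r := by
    clear hr
    induction r with
    | zero => simp
    | succ r ih => rw [pow_succ, mul_assoc, hU, ← mul_assoc, ih, mul_assoc, ← pow_succ]
  rw [pow_sub_compression_pow hE hc hr, ← mul_assoc, hpow, mul_assoc U D]

theorem restrictedHamiltonian_hasMatrix (n : ℕ) :
    HasMatrix (restrictedHamiltonian n) (fourierIntegralMatrix (kDependentBlock n)) :=
  operatorOfMatrix_hasMatrix _ (fourierIntegral_exists _ (kDependentBlock_mem n))

theorem fourierAt_blockHamiltonian_pow (n : ℕ) (hn : 1 ≤ n) (i j : Bits n) {x : ℤ}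
    (hx : 2 * (n : ℤ) < |x|) (r : ℕ) :
    fourierAt x (fun k => (blockHamiltonian n k ^ r) i j) =
      fourierAt x (fun k => (kDependentBlock n k ^ r) i j) := by
  -- Both zeroth powers are the identity; the formula for the difference is available only for `r ≠
  -- 0`.
  rcases eq_or_ne r 0 with rfl | hr
  · simp only [pow_zero]
  obtain ⟨p, rfl⟩ : ∃ p, n = p + 1 := ⟨n - 1, by omega⟩
  rw [← sub_eq_zero, ← fourierAt_sub x
    (trigPoly_continuous (matrix_pow_mem (blockHamiltonian_mem _) r i j))
    (trigPoly_continuous (matrix_pow_mem (kDependentBlock_mem _) r i j))]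
  refine fourierAt_eq_zero (d := 2 * (p + 1)) ?_ (by exact_mod_cast hx)
  convert chainMatrix_conj_mem_trigDegreeLE
    (heavyLabels (p + 1) * chainHamiltonian p ^ r) i j using 1
  funext k
  rw [← blockHamiltonian_pow_sub k hr]
  rfl

end

end SnakeWalk

theorem lemma1 (n : ℕ) (hn : 1 ≤ n) (x₁ x₂ : ℤ) (j₁ j₂ : Fin n → Fin 2)
    (hx : 2 * (n : ℤ) < |x₁ - x₂|) (t : ℝ) :
    inner ℂ (SnakeWalk.ket (x₂, j₂))
        (SnakeWalk.evolution (SnakeWalk.hamiltonian n hn) t (SnakeWalk.ket (x₁, j₁))) =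
      inner ℂ (SnakeWalk.ket (x₂, j₂))
        (SnakeWalk.evolution (SnakeWalk.restrictedHamiltonian n) t (SnakeWalk.ket (x₁, j₁))) := by
  refine SnakeWalk.evolution_inner_eq (fun r => ?_) t
  rw [SnakeWalk.hasMatrix_pow (SnakeWalk.hamiltonian_hasMatrix n hn)
      (SnakeWalk.blockHamiltonian_mem n) r,
    SnakeWalk.hasMatrix_pow (SnakeWalk.restrictedHamiltonian_hasMatrix n)
      (SnakeWalk.kDependentBlock_mem n) r,
    SnakeWalk.fourierIntegralMatrix_eq, SnakeWalk.fourierIntegralMatrix_eq]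
  exact SnakeWalk.fourierAt_blockHamiltonian_pow n hn _ _ (by rwa [abs_sub_comm]) r
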